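/- **Definitions.** A graph is given the path metric in which every edge has length $1$. A *cycle of length $|C|=n\ge 1$ in* a graph $\Gamma$ is a (not necessarily injective) map $f\colon C\to\Gamma$ from a circle $C$ subdivided into $n$ unit edges that sends vertices to vertices and edges isometrically onto edges. For $\xi\in(0,1)$ it is *$\xi$-almost isometric* if $d_\Gamma(f(p),f(q))\ge \xi\,\frac{|C|}{2}$ for every antipodal pair of points $p,q\in C$. A connected simplicial graph is *strongly shortcut* if, for some $\theta\in\mathbb N$ and some $\xi\in(0,1)$, all of its $\xi$-almost isometric cycles have length at most $\theta$. A group is *strongly shortcut* if it acts properly and cocompactly on a strongly shortcut graph. A *CAT(0) cube complex* is a simply connected cube complex all of whose vertex links are flag simplicial complexes. A group is *cocompactly cubulated* if it acts properly and cocompactly on a CAT(0) cube complex. Let $C$ be a cycle with $|C|\ge 1$ edges. A *wall cycle* $(C,\alpha)$ is $C$ together with a surjective coloring $\alpha$ of its edges by a set $W$ of *walls* in which every wall colors an even number of edges. A segment $P\subset C$ *crosses* $w\in W$ if it has an odd number of edges colored $w$, and *begins and ends* with $w$ if its initial and terminal edges are colored $w$. Two distinct walls *cross* if some segment begins and ends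 with one of them and crosses the other. The *dimension* of $(C,\alpha)$ is $\max\{1,k\}$, where $k$ is the size of a largest set of pairwise crossing walls. The *wall crossing distance* $d_\alpha(u,v)$ of two vertices is the number of walls crossed by a segment of $C$ from $u$ to $v$ (it does not depend on the segment). **Theorem.** 1. The $1$-skeleton of every finite-dimensional CAT(0) cube complex is a connected simplicial graph that is strongly shortcut. 2. Every cocompactly cubulated group is strongly shortcut. 3. Let $(C,\alpha)$ be a $d$-dimensional wall cycle. If $$d_\alpha(u,v)\ \ge\ \Bigl(\frac{5d-1}{5d}\Bigr)\frac{|C|}{2}$$ for all antipodal pairs of vertices $u,v$ of $C$, then $$|C|\ \le\ \frac{50d^2}{5d-1}.$$ -/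

import Mathlib

universe u v w

/-! ### Metric graphs and the strong shortcut property

A simplicial graph is a `SimpleGraph`; its geometric realization has every edge isometric to
`[0,1]`, and is equipped with the path metric. -/

/-- A point of the geometric realization of `G` that lies on an edge: the point at distance `pos`
from the initial vertex of the oriented edge `dart`. -/
structure EdgePoint {V : Type u} (G : SimpleGraph V) where
  dart : G.Dart
  pos : ℝ
  pos_nonneg : 0 ≤ pos
  pos_le_one : pos ≤ 1

open Classical in
/-- The path metric of the geometric realization of a connected simplicial graph. Two points of
one edge are joined by a segment of that edge (first two cases: the edge is given with equal or
with opposite orientations); a shortest path between points of distinct edges passes through an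
endpoint of the first edge and an endpoint of the second. -/
noncomputable def EdgePoint.dist {V : Type u} {G : SimpleGraph V} (p q : EdgePoint G) : ℝ :=
  if p.dart = q.dart then |p.pos - q.pos|
  else if p.dart = q.dart.symm then |p.pos - (1 - q.pos)|
  else
    min
      (min (p.pos + G.dist p.dart.fst q.dart.fst + q.pos)
        (p.pos + G.dist p.dart.fst q.dart.snd + (1 - q.pos)))
      (min ((1 - p.pos) + G.dist p.dart.snd q.dart.fst + q.pos)
        ((1 - p.pos) + G.dist p.dart.snd q.dart.snd + (1 - q.pos)))

/-- A cycle of length `n` in `G`: a nondegenerate combinatorial map to `G` from the subdivided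
circle `ℝ / nℤ` whose vertices are the integers modulo `n`. It need not be injective. -/
structure GraphCycle {V : Type u} (G : SimpleGraph V) (n : ℕ) where
  vert : ZMod n → V
  adj : ∀ i, G.Adj (vert i) (vert (i + 1))

/-- The image of the point `t` of the circle `ℝ / nℤ`. -/
noncomputable def GraphCycle.point {V : Type u} {G : SimpleGraph V} {n : ℕ}
    (c : GraphCycle G n) (t : ℝ) : EdgePoint G where
  dart := ⟨(c.vert (⌊t⌋ : ℤ), c.vert ((⌊t⌋ : ℤ) + 1)), c.adj _⟩
  pos := Int.fract t
  pos_nonneg := Int.fract_nonneg t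
  pos_le_one := (Int.fract_lt_one t).le

/-- A cycle is `ξ`-almost isometric if every antipodal pair of points (not only vertices) of the
circle is mapped to a pair of points at distance at least `ξ * (n / 2)`. -/
def GraphCycle.IsAlmostIsometric {V : Type u} {G : SimpleGraph V} {n : ℕ}
    (c : GraphCycle G n) (ξ : ℝ) : Prop :=
  ∀ t : ℝ, ξ * ((n : ℝ) / 2) ≤ (c.point t).dist (c.point (t + (n : ℝ) / 2))

/-- A connected simplicial graph is strongly shortcut if for some `ξ ∈ (0,1)` there is a bound on
the lengths of its `ξ`-almost isometric cycles. -/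
def IsStronglyShortcut {V : Type u} (G : SimpleGraph V) : Prop :=
  G.Connected ∧ ∃ θ : ℕ, ∃ ξ : ℝ, 0 < ξ ∧ ξ < 1 ∧
    ∀ n : ℕ, 0 < n → ∀ c : GraphCycle G n, c.IsAlmostIsometric ξ → n ≤ θ

/-- A group is strongly shortcut if it acts properly (finite vertex stabilizers) and cocompactly
(finitely many orbits of vertices and of edges), by graph automorphisms, on a strongly shortcut
graph. -/
def IsStronglyShortcutGroup (Γ : Type u) [Group Γ] : Prop :=
  ∃ (V : Type u) (_ : MulAction Γ V) (G : SimpleGraph V),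
    IsStronglyShortcut G ∧
    (∀ (g : Γ) (x y : V), G.Adj x y → G.Adj (g • x) (g • y)) ∧
    (∀ x : V, Finite (MulAction.stabilizer Γ x)) ∧
    (∃ S : Set V, S.Finite ∧ ∀ x : V, ∃ g : Γ, g • x ∈ S) ∧
    (∃ E : Set (V × V), E.Finite ∧ ∀ x y : V, G.Adj x y → ∃ g : Γ, (g • x, g • y) ∈ E)

/-! ### Cube complexes -/

/-- An isometric embedding of the cube `[0,1]^m` onto an `m`-dimensional face of `[0,1]^n`, given
by the image `base` of the corner `0` and by the coordinate directions `dir i` of the images of the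
edges at that corner. For `m = n` these are the symmetries of the cube. -/
@[ext]
structure CubeFace (m n : ℕ) where
  base : Fin n → Bool
  dir : Fin m ↪ Fin n

namespace CubeFace

/-- The action of a face embedding on corners of the cube. -/
def apply {m n : ℕ} (f : CubeFace m n) (x : Fin m → Bool) : Fin n → Bool :=
  fun j => xor (f.base j) (decide (∃ i, f.dir i = j ∧ x i = true))

/-- The identity of the cube. -/
def id (n : ℕ) : CubeFace n n := ⟨fun _ => false, Function.Embedding.refl _⟩

/-- Composition of face embeddings: `f.comp g` is `f` after `g`. -/
def comp {l m n : ℕ} (f : CubeFace m n) (g : CubeFace l m) : CubeFace l n :=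
  ⟨f.apply g.base, g.dir.trans f.dir⟩

/-- The inclusion of the corner `x`. -/
def corner {n : ℕ} (x : Fin n → Bool) : CubeFace 0 n := ⟨x, Function.Embedding.ofIsEmpty⟩

/-- The inclusion of the edge that starts at the corner `x` and has direction `i`. -/
def edge {n : ℕ} (x : Fin n → Bool) (i : Fin n) : CubeFace 1 n :=
  ⟨x, ⟨fun _ => i, fun _ _ _ => Subsingleton.elim _ _⟩⟩

/-- The reflection of the interval. -/
def flip : CubeFace 1 1 := ⟨fun _ => true, Function.Embedding.refl _⟩

theorem comp_corner {m n : ℕ} (f : CubeFace m n) (x : Fin m → Bool) :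
    f.comp (corner x) = corner (f.apply x) := by
  ext j
  · rfl
  · exact j.elim0

theorem flip_apply (x : Fin 1 → Bool) : flip.apply x = fun i => !(x i) := by
  funext j
  obtain rfl : j = 0 := Subsingleton.elim _ _
  simp [apply, flip]

end CubeFace

/-- A cube complex: a complex obtained by gluing unit cubes along faces by isometries, where each
open cube embeds. It is recorded through its parametrized cubes: `Cell n` is the set of all
characteristic maps of `n`-cubes, each `n`-cube being counted once for each of the `2 ^ n * n !`
isometric parametrizations by `[0,1]^n`, and `restrict f c` is the characteristic map `c` precomposed
with the face embedding (or symmetry) `f`. Faces of a cube may be identified with each other. -/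
structure CubeComplex where
  Cell : ℕ → Type u
  restrict : ∀ {m n : ℕ}, CubeFace m n → Cell n → Cell m
  restrict_id : ∀ {n : ℕ} (c : Cell n), restrict (CubeFace.id n) c = c
  restrict_comp : ∀ {l m n : ℕ} (f : CubeFace m n) (g : CubeFace l m) (c : Cell n),
    restrict g (restrict f c) = restrict (f.comp g) c
  /-- the open cubes embed: no cube is folded onto itself by a symmetry -/
  free : ∀ {n : ℕ} (f : CubeFace n n) (c : Cell n), restrict f c = c → f = CubeFace.id n

namespace CubeComplex

variable (X : CubeComplex.{u})

/-- The vertex of `c` at the corner `x`. -/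
def vertexAt {n : ℕ} (c : X.Cell n) (x : Fin n → Bool) : X.Cell 0 :=
  X.restrict (CubeFace.corner x) c

/-- The oriented edge of `c` that starts at the corner `x` and has direction `i`. -/
def edgeAt {n : ℕ} (c : X.Cell n) (x : Fin n → Bool) (i : Fin n) : X.Cell 1 :=
  X.restrict (CubeFace.edge x i) c

/-- The initial vertex of an oriented edge. -/
def src (e : X.Cell 1) : X.Cell 0 := X.vertexAt e fun _ => false

/-- The terminal vertex of an oriented edge. -/
def tgt (e : X.Cell 1) : X.Cell 0 := X.vertexAt e fun _ => true

/-- The same edge with the opposite orientation. -/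
def inv (e : X.Cell 1) : X.Cell 1 := X.restrict CubeFace.flip e

theorem src_inv (e : X.Cell 1) : X.src (X.inv e) = X.tgt e := by
  simp only [src, tgt, inv, vertexAt, X.restrict_comp, CubeFace.comp_corner, CubeFace.flip_apply,
    Bool.not_false]

theorem tgt_inv (e : X.Cell 1) : X.tgt (X.inv e) = X.src e := by
  simp only [src, tgt, inv, vertexAt, X.restrict_comp, CubeFace.comp_corner, CubeFace.flip_apply,
    Bool.not_true]

/-- The vertices of the link of `v` are the oriented edges that start at `v`, and its
`(n-1)`-simplices are the corners at `v` of `n`-cubes; after a symmetry of the cube, such a corner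
is the corner `0` of a parametrized cube. The complex is nonpositively curved if all of its links
are flag simplicial complexes:
* the vertices of a simplex of the link are distinct,
* a simplex of the link is determined by its vertices, and
* pairwise adjacent vertices of the link span a simplex. -/
structure IsNonpositivelyCurved : Prop where
  edges_injective : ∀ {n : ℕ} (c : X.Cell n),
    Function.Injective fun i => X.edgeAt c (fun _ => false) i
  eq_of_edges_eq : ∀ {n : ℕ} (c c' : X.Cell n),
    X.vertexAt c (fun _ => false) = X.vertexAt c' (fun _ => false) →
    (∀ i, X.edgeAt c (fun _ => false) i = X.edgeAt c' (fun _ => false) i) → c = c'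
  flag : ∀ (v : X.Cell 0) {n : ℕ} (e : Fin n → X.Cell 1),
    (∀ i, X.src (e i) = v) →
    (∀ i j, i ≠ j → ∃ s : X.Cell 2,
      X.edgeAt s (fun _ => false) 0 = e i ∧ X.edgeAt s (fun _ => false) 1 = e j) →
    ∃ c : X.Cell n, X.vertexAt c (fun _ => false) = v ∧
      ∀ i, X.edgeAt c (fun _ => false) i = e i

/-- A list of oriented edges is an edge path from `a` to `b`. -/
def IsEdgePath : X.Cell 0 → X.Cell 0 → List (X.Cell 1) → Prop
  | a, b, [] => a = b
  | a, b, e :: l => X.src e = a ∧ IsEdgePath (X.tgt e) b l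

/-- Elementary homotopies of edge paths: removing a backtrack, and replacing one half of the
boundary of a square by the other half. -/
inductive ElementaryHomotopy : List (X.Cell 1) → List (X.Cell 1) → Prop
  | backtrack (l₁ l₂ : List (X.Cell 1)) (e : X.Cell 1) :
      ElementaryHomotopy (l₁ ++ [e, X.inv e] ++ l₂) (l₁ ++ l₂)
  | square (l₁ l₂ : List (X.Cell 1)) (s : X.Cell 2) :
      ElementaryHomotopy
        (l₁ ++ [X.edgeAt s ![false, false] 0, X.edgeAt s ![true, false] 1] ++ l₂)
        (l₁ ++ [X.edgeAt s ![false, false] 1, X.edgeAt s ![false, true] 0] ++ l₂)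

/-- The complex is nonempty and connected, and its edge-path group is trivial: each closed edge
path is homotopic to the constant path through edge paths with the same endpoints. -/
structure IsSimplyConnected : Prop where
  nonempty : Nonempty (X.Cell 0)
  connected : ∀ a b : X.Cell 0, ∃ l, X.IsEdgePath a b l
  nullhomotopic : ∀ (a : X.Cell 0) (p : {l // X.IsEdgePath a a l}),
    Relation.EqvGen
      (fun q r : {l // X.IsEdgePath a a l} => X.ElementaryHomotopy q.1 r.1) p ⟨[], rfl⟩

/-- A `CAT(0)` cube complex: a simply connected cube complex all of whose vertex links are flag
simplicial complexes. -/
structure IsCAT0 : Prop where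
  simplyConnected : X.IsSimplyConnected
  nonpositivelyCurved : X.IsNonpositivelyCurved

/-- There is a bound on the dimensions of the cubes. -/
def IsFiniteDimensional : Prop := ∃ d : ℕ, ∀ n, d < n → IsEmpty (X.Cell n)

/-- The `1`-skeleton is a simplicial graph: no loops and no multiple edges. -/
structure HasSimplicialSkeleton : Prop where
  no_loop : ∀ e : X.Cell 1, X.src e ≠ X.tgt e
  no_multiple : ∀ e e' : X.Cell 1, X.src e = X.src e' → X.tgt e = X.tgt e' → e = e'

/-- The `1`-skeleton as a simplicial graph (the actual `1`-skeleton if that is simplicial). -/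
def oneSkeleton : SimpleGraph (X.Cell 0) where
  Adj a b := a ≠ b ∧ ∃ e : X.Cell 1, X.src e = a ∧ X.tgt e = b
  symm := ⟨by
    rintro a b ⟨hab, e, ha, hb⟩
    exact ⟨hab.symm, X.inv e, (X.src_inv e).trans hb, (X.tgt_inv e).trans ha⟩⟩
  loopless := ⟨fun _ h => h.1 rfl⟩

end CubeComplex

/-- A group is cocompactly cubulated if it acts properly (finite vertex stabilizers) and
cocompactly (finitely many orbits of cubes), by automorphisms of cube complexes, on a `CAT(0)` cube
complex. -/
def IsCocompactlyCubulated (Γ : Type u) [Group Γ] : Prop :=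
  ∃ (X : CubeComplex.{u}) (_ : ∀ n, MulAction Γ (X.Cell n)),
    X.IsCAT0 ∧
    (∀ (g : Γ) {m n : ℕ} (f : CubeFace m n) (c : X.Cell n),
      X.restrict f (g • c) = g • X.restrict f c) ∧
    (∀ x : X.Cell 0, Finite (MulAction.stabilizer Γ x)) ∧
    (∃ S : Set (Σ n, X.Cell n), S.Finite ∧
      ∀ (n : ℕ) (c : X.Cell n), ∃ g : Γ, (⟨n, g • c⟩ : Σ n, X.Cell n) ∈ S)

/-! ### Wall cycles

The cycle of length `n` has vertex set `ZMod n`, and its edge `i` joins the vertices `i` and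
`i + 1`. The segment `(i, k)` starts at the vertex `i` and consists of the edges
`i, i + 1, …, i + k - 1`. -/

section WallCycle

variable {n : ℕ} {W : Type w}

/-- A surjective edge coloring in which each color is used an even number of times. -/
def IsWallCycle (α : ZMod n → W) : Prop :=
  Function.Surjective α ∧ ∀ x : W, Even (α ⁻¹' {x}).ncard

/-- The segment `(i, k)` crosses the wall `x`: it has an odd number of edges of color `x`. -/
def SegmentCrosses (α : ZMod n → W) (i : ZMod n) (k : ℕ) (x : W) : Prop :=
  Odd {j : ℕ | j < k ∧ α (i + (j : ZMod n)) = x}.ncard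

/-- The segment `(i, k)` begins and ends with the wall `x`. -/
def SegmentBeginsEnds (α : ZMod n → W) (i : ZMod n) (k : ℕ) (x : W) : Prop :=
  1 ≤ k ∧ α i = x ∧ α (i + ((k - 1 : ℕ) : ZMod n)) = x

/-- Two distinct walls cross if some segment begins and ends with one and crosses the other. -/
def WallsCross (α : ZMod n → W) (x y : W) : Prop :=
  x ≠ y ∧ ∃ (i : ZMod n) (k : ℕ), k < n ∧
    ((SegmentBeginsEnds α i k x ∧ SegmentCrosses α i k y) ∨
      (SegmentBeginsEnds α i k y ∧ SegmentCrosses α i k x))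

/-- The dimension of a wall cycle: the maximum of `1` and of the largest size of a set of pairwise
crossing walls. -/
noncomputable def wallDim (α : ZMod n → W) : ℕ :=
  max 1 (sSup {k : ℕ | ∃ S : Finset W,
    (∀ x ∈ S, ∀ y ∈ S, x ≠ y → WallsCross α x y) ∧ S.card = k})

/-- The wall crossing distance: the number of walls crossed by the segment from `a` to `b`. -/
noncomputable def wallDist (α : ZMod n → W) (a b : ZMod n) : ℕ :=
  {x : W | SegmentCrosses α a (b - a).val x}.ncard

end WallCycle

/-! Wall cycles. Write `n = 2 * m`. If antipodal vertices are almost `m` walls apart, most walls are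
crossed by the half `[0, m)` and have just two edges, one in each half, at `p x < m ≤ q x`. Order
these walls by letting `x` precede `y` when `p x < p y` and `q x < q y`. Comparable walls interleave
on the circle and therefore cross, so a chain has at most `d` elements. In an antichain the pairs
are nested; some window of length `m` separates the two edges of at most one of them, so the ends of
that window are separated by few walls. As there are at most `m` walls, the hypothesis bounds the
antichain by `m / (5 * d) + 1`. Mirsky's theorem (`card_le_mul_or_exists_chain`) bounds the number
of two-edge walls by `m / 5 + d`, against the lower bound `m - 2 * m / (5 * d)`; hence `m` is
bounded.

Cube complexes. A cycle in the 1-skeleton, colored by the hyperplanes dual to its edges, is a wall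
cycle. The bound applies to it once the wall crossing distance is the combinatorial distance and
walls that cross in the cycle cross in the complex; pairwise crossing hyperplanes are dual to a
cube, so the dimension of the wall cycle is controlled by that of the complex.

These facts about hyperplanes come from a rewriting argument. Call two edge paths equivalent if they
differ by flips across squares. The cube condition makes flips coherent: equivalent paths with
different first edges may both be led around one square (`eqv_cons_cons`). Hence prepending an edge
and cancelling a backtrack is well defined on classes of reduced paths, and elementary homotopies
act trivially (`act_inv`, `act_sq`). By simple connectivity, all reduced paths between two vertices
are equivalent. They are therefore the geodesics, and two edges pointing towards the same vertex
span a square. From this it follows that hyperplanes have two sides, that geodesics cross each at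
most once, and that pairwise crossing hyperplanes meet at a common vertex. -/

/-! ### Wall cycles -/

/-- Mirsky's theorem, in the form of a dichotomy. -/
theorem card_le_mul_or_exists_chain {ι : Type*} (r : ι → ι → Prop) [IsTrans ι r] [Std.Irrefl r]
    (c : ℕ) (d : ℕ) (s : Finset ι)
    (hs : ∀ A ⊆ s, (∀ x ∈ A, ∀ y ∈ A, ¬ r x y) → A.card ≤ c) :
    s.card ≤ d * c ∨
      ∃ T ⊆ s, T.card = d + 1 ∧ ∀ x ∈ T, ∀ y ∈ T, x ≠ y → r x y ∨ r y x := by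
  classical
  -- Demanding a least element of the chain is what lets the induction extend it downwards.
  suffices H : s.card ≤ d * c ∨ ∃ T ⊆ s, T.card = d + 1 ∧
      (∀ x ∈ T, ∀ y ∈ T, x ≠ y → r x y ∨ r y x) ∧ ∃ x ∈ T, ∀ y ∈ T, y ≠ x → r x y by
    rcases H with H | ⟨T, h1, h2, h3, -⟩
    · exact Or.inl H
    · exact Or.inr ⟨T, h1, h2, h3⟩
  induction d generalizing s with
  | zero =>
    rcases s.eq_empty_or_nonempty with rfl | ⟨x, hx⟩
    · simp
    · refine Or.inr ⟨{x}, by simpa using hx, by simp, by simp, x, by simp, by simp⟩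
  | succ d ih =>
    -- The minimal elements of `s` form an antichain. A chain in the rest has a least element that
    -- is not minimal in `s`, so something below it can be added.
    set A := s.filter (fun x => ∀ y ∈ s, ¬ r y x) with hA
    have hAc : A.card ≤ c := hs A (Finset.filter_subset _ _) fun x hx y hy h =>
      (Finset.mem_filter.1 hy).2 x (Finset.mem_filter.1 hx).1 h
    rcases ih (s \ A) (fun B hB h => hs B (hB.trans Finset.sdiff_subset) h) with
      h | ⟨T, hT, hc, hch, x, hx, hmin⟩
    · left
      have := Finset.card_le_card_sdiff_add_card (s := s) (t := A)
      rw [add_mul, one_mul]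
      omega
    · right
      have hxs := Finset.mem_sdiff.1 (hT hx)
      obtain ⟨y, hy, hyx⟩ : ∃ y ∈ s, r y x := by
        by_contra! hcon
        exact hxs.2 (Finset.mem_filter.2 ⟨hxs.1, hcon⟩)
      have hyT : ∀ z ∈ T, r y z := fun z hz => by
        by_cases hzx : z = x
        · exact hzx ▸ hyx
        · exact _root_.trans hyx (hmin z hz hzx)
      have hyn : y ∉ T := fun h => irrefl y (hyT y h)
      refine ⟨insert y T, Finset.insert_subset hy (hT.trans Finset.sdiff_subset), by
        rw [Finset.card_insert_of_notMem hyn, hc], ?_, y, Finset.mem_insert_self _ _, ?_⟩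
      · intro a ha b hb hab
        rcases Finset.mem_insert.1 ha with rfl | ha' <;>
          rcases Finset.mem_insert.1 hb with rfl | hb'
        · exact absurd rfl hab
        · exact Or.inl (hyT b hb')
        · exact Or.inr (hyT a ha')
        · exact hch a ha' b hb' hab
      · intro z hz hzy
        exact hyT z (Finset.mem_of_mem_insert_of_ne hz hzy)

/-- In a family of nested pairs `p i < q i`, at most one is split by a suitable window of
length `m`. -/
theorem exists_window {ι : Type*} [DecidableEq ι] (A : Finset ι) (m : ℕ) (p q : ι → ℕ)
    (hq : ∀ x ∈ A, m ≤ q x ∧ q x < 2 * m)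
    (hpi : ∀ x ∈ A, ∀ y ∈ A, p x = p y → x = y) (hqi : ∀ x ∈ A, ∀ y ∈ A, q x = q y → x = y)
    (hA : ∀ x ∈ A, ∀ y ∈ A, ¬ (p x < p y ∧ q x < q y)) :
    ∃ t ≤ m, A.card ≤ (A.filter fun x => t ≤ p x ↔ q x < t + m).card + 1 := by
  -- For `p x < m ≤ q x` and `t ≤ m`, the window `[t, t + m)` misses the first edge exactly for `x ∈
  -- I t` and the second exactly for `x ∈ J t`; it splits the pair when `x` lies in just one of
  -- these sets.
  set I : ℕ → Finset ι := fun t => A.filter fun x => p x < t with hI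
  set J : ℕ → Finset ι := fun t => A.filter fun x => t + m ≤ q x with hJ
  have hex : ∃ t, (J t).card ≤ (I t).card := by
    refine ⟨m, ?_⟩
    have : J m = ∅ := by
      apply Finset.filter_eq_empty_iff.2
      intro x hx
      have := hq x hx
      omega
    simp [this]
  classical
  set t := Nat.find hex with ht
  have h1 : (J t).card ≤ (I t).card := Nat.find_spec hex
  have htm : t ≤ m := by
    apply Nat.find_min'
    have : J m = ∅ := by
      apply Finset.filter_eq_empty_iff.2
      intro x hx
      have := hq x hx
      omega
    simp [this]
  -- As `t` grows by one, `I` gains and `J` loses at most one element, so at the first `t` with `(J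
  -- t).card ≤ (I t).card` the sizes differ by at most one.
  have h2 : (I t).card ≤ (J t).card + 1 := by
    rcases Nat.eq_zero_or_pos t with h0 | hpos
    · simp [hI, h0]
    · obtain ⟨s, hs⟩ : ∃ s, t = s + 1 := ⟨t - 1, by omega⟩
      have hlt : (I s).card < (J s).card := by
        have := Nat.find_min hex (m := s) (by omega)
        omega
      have hI1 : (I t).card ≤ (I s).card + 1 := by
        have hsub : I t \ I s ⊆ A.filter fun x => p x = s := by
          intro x hx
          simp only [hI, Finset.mem_sdiff, Finset.mem_filter] at hx ⊢
          refine ⟨hx.1.1, ?_⟩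
          have := hx.1.2
          have h3 : ¬ p x < s := fun h => hx.2 ⟨hx.1.1, h⟩
          omega
        have hone : (A.filter fun x => p x = s).card ≤ 1 := Finset.card_le_one.2 fun a ha b hb => by
          simp only [Finset.mem_filter] at ha hb
          exact hpi a ha.1 b hb.1 (ha.2.trans hb.2.symm)
        have := Finset.card_le_card hsub
        have := Finset.card_le_card_sdiff_add_card (s := I t) (t := I s)
        omega
      have hJ1 : (J s).card ≤ (J t).card + 1 := by
        have hsub : J s \ J t ⊆ A.filter fun x => q x = s + m := by
          intro x hx
          simp only [hJ, Finset.mem_sdiff, Finset.mem_filter] at hx ⊢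
          refine ⟨hx.1.1, ?_⟩
          have := hx.1.2
          have h3 : ¬ t + m ≤ q x := fun h => hx.2 ⟨hx.1.1, h⟩
          omega
        have hone : (A.filter fun x => q x = s + m).card ≤ 1 :=
          Finset.card_le_one.2 fun a ha b hb => by
            simp only [Finset.mem_filter] at ha hb
            exact hqi a ha.1 b hb.1 (ha.2.trans hb.2.symm)
        have := Finset.card_le_card hsub
        have := Finset.card_le_card_sdiff_add_card (s := J s) (t := J t)
        omega
      omega
  -- Nestedness makes small `p` go with large `q`, so `I t` and `J t` are comparable under
  -- inclusion, and the cardinalities decide the direction.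
  have hnest : J t ⊆ I t := by
    by_contra hcon
    obtain ⟨x, hx, hxI⟩ := Finset.not_subset.1 hcon
    have hsub : I t ⊆ (J t).erase x := by
      intro y hy
      have hyx : y ≠ x := fun h => hxI (h ▸ hy)
      simp only [hI, hJ, Finset.mem_filter, Finset.mem_erase, not_and, not_lt] at hx hy hxI ⊢
      refine ⟨hyx, hy.1, ?_⟩
      have h3 := hxI hx.1
      have h4 := hA y hy.1 x hx.1
      by_contra h5
      exact h4 ⟨by omega, by omega⟩
    have := Finset.card_le_card hsub
    have := Finset.card_erase_lt_of_mem hx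
    omega
  refine ⟨t, htm, ?_⟩
  have hcov : A ⊆ (A.filter fun x => t ≤ p x ↔ q x < t + m) ∪ (I t \ J t) := by
    intro x hx
    simp only [hI, hJ, Finset.mem_union, Finset.mem_sdiff, Finset.mem_filter, not_and, not_le]
    by_cases h : p x < t
    · by_cases h' : t + m ≤ q x
      · left; exact ⟨hx, by omega⟩
      · right; exact ⟨⟨hx, h⟩, fun _ => by omega⟩
    · have : x ∉ J t := fun h' => h (Finset.mem_filter.1 (hnest h')).2
      simp only [hJ, Finset.mem_filter, not_and, not_le] at this
      left; exact ⟨hx, by have := this hx; omega⟩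
  have h3 := (Finset.card_le_card hcov).trans (Finset.card_union_le _ _)
  have h4 := Finset.card_sdiff_of_subset hnest
  omega

/-! ### Counting the walls of a wall cycle -/

section WallCycle

variable {n : ℕ} {W : Type w}

open Classical in
theorem ncard_segment (α : ZMod n → W) (i : ZMod n) (k : ℕ) (x : W) :
    {j : ℕ | j < k ∧ α (i + (j : ZMod n)) = x}.ncard =
      ((Finset.range k).filter fun j : ℕ => α (i + (j : ZMod n)) = x).card := by
  rw [← Set.ncard_coe_finset]
  congr 1
  ext j
  simp

open Classical in
theorem ncard_fiber (hn : 0 < n) (α : ZMod n → W) (x : W) :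
    (α ⁻¹' {x}).ncard = ((Finset.range n).filter fun j : ℕ => α (j : ZMod n) = x).card := by
  have : NeZero n := ⟨hn.ne'⟩
  rw [← Set.ncard_coe_finset]
  have himg : α ⁻¹' {x} = (fun j : ℕ => (j : ZMod n)) ''
      (((Finset.range n).filter fun j : ℕ => α (j : ZMod n) = x : Finset ℕ) : Set ℕ) := by
    ext z
    simp only [Set.mem_preimage, Set.mem_singleton_iff, Set.mem_image, Finset.coe_filter,
      Finset.mem_range, Set.mem_ofPred_eq]
    constructor
    · intro h
      exact ⟨z.val, ⟨ZMod.val_lt z, by simpa using h⟩, by simp⟩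
    · rintro ⟨j, ⟨-, h⟩, rfl⟩
      exact h
  rw [himg]
  apply Set.InjOn.ncard_image
  intro a ha b hb hab
  simp only [Finset.coe_filter, Finset.mem_range, Set.mem_ofPred_eq] at ha hb
  have := (ZMod.natCast_eq_natCast_iff' a b n).1 hab
  rwa [Nat.mod_eq_of_lt ha.1, Nat.mod_eq_of_lt hb.1] at this

theorem card_le_wallDim [Finite W] (α : ZMod n → W) (S : Finset W)
    (hS : ∀ x ∈ S, ∀ y ∈ S, x ≠ y → WallsCross α x y) : S.card ≤ wallDim α := by
  have := Fintype.ofFinite W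
  refine le_trans (le_csSup (s := {k : ℕ | ∃ S : Finset W,
    (∀ x ∈ S, ∀ y ∈ S, x ≠ y → WallsCross α x y) ∧ S.card = k})
    ⟨Fintype.card W, ?_⟩ ⟨S, hS, rfl⟩) (le_max_right _ _)
  rintro k ⟨T, -, rfl⟩
  exact Finset.card_le_univ T

open Classical in
theorem wallDist_eq_card [Fintype W] (α : ZMod n → W) (a b : ZMod n) :
    wallDist α a b = (Finset.univ.filter fun x => SegmentCrosses α a (b - a).val x).card := by
  rw [wallDist, ← Set.ncard_coe_finset]
  congr 1
  ext x
  simp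

open Classical in
theorem two_mul_card_walls_le (hn : 0 < n) [Fintype W] (α : ZMod n → W) (hα : IsWallCycle α) :
    2 * Fintype.card W ≤ n := by
  have h1 := Finset.card_eq_sum_card_fiberwise (s := Finset.range n) (t := Finset.univ)
    (f := fun j : ℕ => α (j : ZMod n)) (fun _ _ => Finset.mem_coe.2 (Finset.mem_univ _))
  rw [Finset.card_range] at h1
  rw [h1, mul_comm, ← smul_eq_mul, ← Finset.card_univ]
  apply Finset.card_nsmul_le_sum
  intro x _
  have h2 := hα.2 x
  rw [ncard_fiber hn] at h2
  have : NeZero n := ⟨hn.ne'⟩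
  obtain ⟨z, hz⟩ := hα.1 x
  have h3 : 0 < ((Finset.range n).filter fun j : ℕ => α (j : ZMod n) = x).card :=
    Finset.card_pos.2 ⟨z.val, by simp [ZMod.val_lt z, hz]⟩
  obtain ⟨k, hk⟩ := h2
  omega

open Classical in
/-- The walls crossed by the half `[0, m)` having exactly two edges. -/
theorem card_good_walls {m : ℕ} (hm : 0 < m) (hn : n = 2 * m) [Fintype W] (α : ZMod n → W)
    (hα : IsWallCycle α) :
    2 * wallDist α 0 (m : ZMod n) ≤ m + (Finset.univ.filter fun x =>
      SegmentCrosses α 0 m x ∧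
        ((Finset.range n).filter fun j : ℕ => α (j : ZMod n) = x).card = 2).card := by
  have h1 := Finset.card_eq_sum_card_fiberwise (s := Finset.range n) (t := Finset.univ)
    (f := fun j : ℕ => α (j : ZMod n)) (fun _ _ => Finset.mem_coe.2 (Finset.mem_univ _))
  rw [Finset.card_range] at h1
  have hv : ((m : ZMod n) - 0).val = m := by
    rw [sub_zero, ZMod.val_natCast, Nat.mod_eq_of_lt (by omega)]
  rw [wallDist_eq_card, hv]
  set K := Finset.univ.filter fun x => SegmentCrosses α 0 m x
  set G := Finset.univ.filter fun x => SegmentCrosses α 0 m x ∧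
        ((Finset.range n).filter fun j : ℕ => α (j : ZMod n) = x).card = 2
  have hGK : G ⊆ K := fun x hx =>
    Finset.mem_filter.2 ⟨Finset.mem_univ _, (Finset.mem_filter.1 hx).2.1⟩
  have h2 : ∑ x ∈ K, ((Finset.range n).filter fun j : ℕ => α (j : ZMod n) = x).card ≤ n := by
    conv_rhs => rw [h1]
    exact Finset.sum_le_sum_of_subset (Finset.subset_univ _)
  rw [← Finset.sum_sdiff hGK] at h2
  have h3 : G.card • 2 ≤
      ∑ x ∈ G, ((Finset.range n).filter fun j : ℕ => α (j : ZMod n) = x).card :=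
    Finset.card_nsmul_le_sum _ _ _ fun x hx => (Finset.mem_filter.1 hx).2.2.ge
  -- The number of edges of such a wall is even, positive and not two.
  have h4 : (K \ G).card • 4 ≤
      ∑ x ∈ K \ G, ((Finset.range n).filter fun j : ℕ => α (j : ZMod n) = x).card := by
    apply Finset.card_nsmul_le_sum
    intro x hx
    simp only [K, G, Finset.mem_sdiff, Finset.mem_filter, Finset.mem_univ, true_and, not_and] at hx
    have h5 := hx.2 hx.1
    obtain ⟨k, hk⟩ := hα.2 x
    rw [ncard_fiber (by omega)] at hk
    have h6 := hx.1
    rw [SegmentCrosses, ncard_segment] at h6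
    have h7 := h6.pos
    have h8 : ((Finset.range m).filter fun j : ℕ => α (0 + (j : ZMod n)) = x).card ≤
        ((Finset.range n).filter fun j : ℕ => α (j : ZMod n) = x).card := by
      apply Finset.card_le_card
      intro j
      simp only [Finset.mem_filter, Finset.mem_range, zero_add]
      exact fun h => ⟨by omega, h.2⟩
    omega
  have h5 := Finset.card_sdiff_add_card_eq_card hGK
  simp only [smul_eq_mul] at h3 h4
  omega

open Classical in
theorem exists_edges_of_good {m : ℕ} (hn : n = 2 * m) (α : ZMod n → W) (x : W)
    (hx : SegmentCrosses α 0 m x)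
    (h2 : ((Finset.range n).filter fun j : ℕ => α (j : ZMod n) = x).card = 2) :
    ∃ p q : ℕ, p < m ∧ m ≤ q ∧ q < 2 * m ∧
      ∀ j < n, α (j : ZMod n) = x ↔ j = p ∨ j = q := by
  obtain ⟨a, b, hab, hS⟩ := Finset.card_eq_two.1 h2
  have key : ∀ j < n, α (j : ZMod n) = x ↔ j = a ∨ j = b := by
    intro j hj
    have := Finset.ext_iff.1 hS j
    simpa [hj] using this
  have ha : a < n := by
    have : a ∈ ({a, b} : Finset ℕ) := by simp
    rw [← hS] at this
    simpa using (Finset.mem_filter.1 this).1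
  have hb : b < n := by
    have : b ∈ ({a, b} : Finset ℕ) := by simp
    rw [← hS] at this
    simpa using (Finset.mem_filter.1 this).1
  have hc : (Finset.range m).filter (fun j : ℕ => α (0 + (j : ZMod n)) = x) =
      ({a, b} : Finset ℕ).filter (fun j => j < m) := by
    ext j
    simp only [Finset.mem_filter, Finset.mem_range, zero_add, Finset.mem_insert,
      Finset.mem_singleton]
    constructor
    · rintro ⟨h, h'⟩
      exact ⟨(key j (by omega)).1 h', h⟩
    · rintro ⟨h, h'⟩
      exact ⟨h', (key j (by omega)).2 h⟩
  -- Oddness of the count in the first half forces exactly one of the two edges into it.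
  rw [SegmentCrosses, ncard_segment, hc] at hx
  by_cases h1 : a < m <;> by_cases h3 : b < m
  · rw [Finset.filter_true_of_mem (by simp [h1, h3]), Finset.card_pair hab] at hx
    exact absurd hx (by decide)
  · exact ⟨a, b, h1, by omega, by omega, key⟩
  · exact ⟨b, a, h3, by omega, by omega, fun j hj => by rw [key j hj, or_comm]⟩
  · rw [Finset.filter_false_of_mem (by simp; omega)] at hx
    exact absurd hx (by decide)

open Classical in
theorem wallsCross_of_interleaved {m : ℕ} (hn : n = 2 * m) (α : ZMod n → W) {x y : W}
    {p q p' q' : ℕ} (hp' : p' < m) (hq : m ≤ q) (hq' : q' < 2 * m)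
    (hpp : p < p') (hqq : q < q')
    (hx : ∀ j < n, α (j : ZMod n) = x ↔ j = p ∨ j = q)
    (hy : ∀ j < n, α (j : ZMod n) = y ↔ j = p' ∨ j = q') : WallsCross α x y := by
  -- The segment runs from edge `p` through edge `q`; it is shorter than `n` because `q < q' < 2 *
  -- m`. Of the edges colored `y`, it contains `p'` but not `q'`.
  refine ⟨?_, (p : ZMod n), q - p + 1, by omega, Or.inl ⟨⟨by omega, ?_, ?_⟩, ?_⟩⟩
  · rintro rfl
    have := (hx p' (by omega)).1 ((hy p' (by omega)).2 (Or.inl rfl))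
    omega
  · exact (hx p (by omega)).2 (Or.inl rfl)
  · have : (p : ZMod n) + ((q - p + 1 - 1 : ℕ) : ZMod n) = (q : ZMod n) := by
      rw [← Nat.cast_add]
      congr 1
      omega
    rw [this]
    exact (hx q (by omega)).2 (Or.inr rfl)
  · rw [SegmentCrosses, ncard_segment]
    have : (Finset.range (q - p + 1)).filter (fun j : ℕ => α ((p : ZMod n) + (j : ZMod n)) = y) =
        {p' - p} := by
      ext j
      simp only [Finset.mem_filter, Finset.mem_range, Finset.mem_singleton, ← Nat.cast_add]
      constructor
      · rintro ⟨h, h'⟩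
        have := (hy _ (by omega)).1 h'
        omega
      · rintro rfl
        exact ⟨by omega, (hy _ (by omega)).2 (by omega)⟩
    rw [this]
    simp

-- The hypothesis `h` says that the window contains both edges of `x` or neither, an even number in
-- either case.
open Classical in
theorem not_segmentCrosses_window {m : ℕ} (hn : n = 2 * m) (α : ZMod n → W) {x : W} {p q t : ℕ}
    (hp : p < m) (hq : m ≤ q) (hq' : q < 2 * m) (ht : t ≤ m)
    (hx : ∀ j < n, α (j : ZMod n) = x ↔ j = p ∨ j = q) (h : t ≤ p ↔ q < t + m) :
    ¬ SegmentCrosses α (t : ZMod n) m x := by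
  rw [SegmentCrosses, ncard_segment]
  by_cases htp : t ≤ p
  · have : (Finset.range m).filter (fun j : ℕ => α ((t : ZMod n) + (j : ZMod n)) = x) =
        {p - t, q - t} := by
      ext j
      simp only [Finset.mem_filter, Finset.mem_range, Finset.mem_singleton, ← Nat.cast_add,
        Finset.mem_insert]
      constructor
      · rintro ⟨h, h'⟩
        have := (hx _ (by omega)).1 h'
        omega
      · intro h'
        exact ⟨by omega, (hx _ (by omega)).2 (by omega)⟩
    rw [this, Finset.card_pair (by omega)]
    decide
  · have : (Finset.range m).filter (fun j : ℕ => α ((t : ZMod n) + (j : ZMod n)) = x) = ∅ := by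
      ext j
      simp only [Finset.mem_filter, Finset.mem_range, ← Nat.cast_add, Finset.notMem_empty,
        iff_false, not_and]
      intro h1 h'
      have := (hx _ (by omega)).1 h'
      omega
    rw [this]
    decide

theorem length_le_of_wallDist_ge (hn : 0 < n) (α : ZMod n → W) (d : ℕ) (hα : IsWallCycle α)
    (hd : d = wallDim α)
    (h : ∀ a b : ZMod n, 2 * (b - a).val = n →
        (5 * (d : ℝ) - 1) / (5 * (d : ℝ)) * ((n : ℝ) / 2) ≤ (wallDist α a b : ℝ)) :
    (n : ℝ) ≤ 50 * (d : ℝ) ^ 2 / (5 * (d : ℝ) - 1) := by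
  classical
  have : NeZero n := ⟨hn.ne'⟩
  have : Finite W := Finite.of_surjective α hα.1
  have := Fintype.ofFinite W
  have hd1 : 1 ≤ d := hd ▸ le_max_left _ _
  have heven : Even n := by
    have h1 := Finset.card_eq_sum_card_fiberwise (s := Finset.range n) (t := Finset.univ)
      (f := fun j : ℕ => α (j : ZMod n)) (fun _ _ => Finset.mem_coe.2 (Finset.mem_univ _))
    rw [Finset.card_range] at h1
    rw [h1]
    refine Finset.even_sum _ fun x _ => ?_
    rw [← ncard_fiber hn]
    exact hα.2 x
  obtain ⟨m, hm⟩ := heven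
  have hnm : n = 2 * m := by omega
  have hm0 : 0 < m := by omega
  have hant : ∀ t : ZMod n, (t + (m : ZMod n) - t).val = m := fun t => by
    rw [add_sub_cancel_left, ZMod.val_natCast, Nat.mod_eq_of_lt (by omega)]
  have hcast : (n : ℝ) / 2 = m := by rw [hnm]; push_cast; ring
  set G := Finset.univ.filter fun x =>
      SegmentCrosses α 0 m x ∧
        ((Finset.range n).filter fun j : ℕ => α (j : ZMod n) = x).card = 2 with hG
  have hgood := card_good_walls hm0 hnm α hα
  rw [← hG] at hgood
  choose! p q hp hq hq' hpq using fun x (hx : x ∈ G) =>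
    exists_edges_of_good hnm α x (Finset.mem_filter.1 hx).2.1 (Finset.mem_filter.1 hx).2.2
  have hpi : ∀ x ∈ G, ∀ y ∈ G, p x = p y → x = y := fun x hx y hy hxy => by
    have h1 := (hpq x hx (p x) (by have := hp x hx; omega)).2 (Or.inl rfl)
    have h2 := (hpq y hy (p y) (by have := hp y hy; omega)).2 (Or.inl rfl)
    rw [← h1, ← h2, hxy]
  have hqi : ∀ x ∈ G, ∀ y ∈ G, q x = q y → x = y := fun x hx y hy hxy => by
    have h1 := (hpq x hx (q x) (by have := hq' x hx; omega)).2 (Or.inr rfl)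
    have h2 := (hpq y hy (q y) (by have := hq' y hy; omega)).2 (Or.inr rfl)
    rw [← h1, ← h2, hxy]
  have hN := two_mul_card_walls_le hn α hα
  -- nested families of good walls are small
  have hnested : ∀ A ⊆ G, (∀ x ∈ A, ∀ y ∈ A, ¬ (p x < p y ∧ q x < q y)) →
      (A.card : ℝ) ≤ m / (5 * d) + 1 := by
    intro A hA hAnest
    obtain ⟨t, htm, ht⟩ := exists_window A m p q (fun x hx => ⟨hq x (hA hx), hq' x (hA hx)⟩)
      (fun x hx y hy => hpi x (hA hx) y (hA hy)) (fun x hx y hy => hqi x (hA hx) y (hA hy)) hAnest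
    have h1 := h (t : ZMod n) ((t : ZMod n) + (m : ZMod n)) (by rw [hant, hnm])
    rw [hcast, wallDist_eq_card, hant] at h1
    -- Walls crossed by the window and walls of `A` not split by it are disjoint families, and there
    -- are at most `m` walls in all.
    have h2 : (Finset.univ.filter fun x => SegmentCrosses α (t : ZMod n) m x).card +
        (A.filter fun x => t ≤ p x ↔ q x < t + m).card ≤ Fintype.card W := by
      rw [← Finset.card_union_of_disjoint]
      · exact Finset.card_le_univ _
      · rw [Finset.disjoint_left]
        intro x hx hx'
        have hx2 := Finset.mem_filter.1 hx'
        have hxG := hA hx2.1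
        exact not_segmentCrosses_window hnm α (hp x hxG) (hq x hxG) (hq' x hxG) htm (hpq x hxG)
          hx2.2 (Finset.mem_filter.1 hx).2
    have h3 : (Finset.univ.filter fun x => SegmentCrosses α (t : ZMod n) m x).card + A.card ≤
        m + 1 := by omega
    have h4 : ((Finset.univ.filter fun x => SegmentCrosses α (t : ZMod n) m x).card : ℝ) + A.card ≤
        m + 1 := by exact_mod_cast h3
    have h5 : (5 * (d : ℝ) - 1) / (5 * (d : ℝ)) * m = m - m / (5 * d) := by
      have : (d : ℝ) ≠ 0 := by positivity
      field_simp
    linarith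
  have : IsTrans W fun x y => p x < p y ∧ q x < q y :=
    ⟨fun _ _ _ h1 h2 => ⟨h1.1.trans h2.1, h1.2.trans h2.2⟩⟩
  have : Std.Irrefl fun x y : W => p x < p y ∧ q x < q y := ⟨fun _ h1 => lt_irrefl _ h1.1⟩
  have hdR : (1 : ℝ) ≤ d := by exact_mod_cast hd1
  have hGle : (G.card : ℝ) ≤ d * (m / (5 * d) + 1) := by
    -- A chain of `d + 1` good walls would be pairwise crossing, exceeding the dimension.
    rcases card_le_mul_or_exists_chain (fun x y : W => p x < p y ∧ q x < q y)
      ⌊(m : ℝ) / (5 * d) + 1⌋₊ d G (fun A hA hAn => Nat.le_floor (hnested A hA hAn)) with h1 | h1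
    · calc (G.card : ℝ) ≤ ((d * ⌊(m : ℝ) / (5 * d) + 1⌋₊ : ℕ) : ℝ) := by exact_mod_cast h1
        _ = d * (⌊(m : ℝ) / (5 * d) + 1⌋₊ : ℝ) := by push_cast; rfl
        _ ≤ d * (m / (5 * d) + 1) := by
          gcongr
          exact Nat.floor_le (by positivity)
    · exfalso
      obtain ⟨T, hT, hTc, hTch⟩ := h1
      have h2 := card_le_wallDim α T (by
        intro x hx y hy hxy
        have hxG := hT hx
        have hyG := hT hy
        rcases hTch x hx y hy hxy with h2 | h2
        · exact wallsCross_of_interleaved hnm α (hp y hyG) (hq x hxG) (hq' y hyG) h2.1 h2.2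
            (hpq x hxG) (hpq y hyG)
        · obtain ⟨-, i, k, hk, h4⟩ := wallsCross_of_interleaved hnm α (hp x hxG) (hq y hyG)
            (hq' x hxG) h2.1 h2.2 (hpq y hyG) (hpq x hxG)
          exact ⟨hxy, i, k, hk, h4.symm⟩)
      omega
  have h0 := h 0 (0 + (m : ZMod n)) (by rw [hant, hnm])
  rw [hcast, zero_add] at h0
  have hgoodR : 2 * (wallDist α 0 (m : ZMod n) : ℝ) ≤ m + G.card := by exact_mod_cast hgood
  have e1 : (5 * (d : ℝ) - 1) / (5 * (d : ℝ)) * m = m - m / (5 * d) := by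
    have : (d : ℝ) ≠ 0 := by positivity
    field_simp
  have e2 : (d : ℝ) * (m / (5 * d) + 1) = m / 5 + d := by
    have : (d : ℝ) ≠ 0 := by positivity
    field_simp
  rw [e1] at h0
  rw [e2] at hGle
  have e3 : (m : ℝ) * 4 / 5 - 2 * (m / (5 * d)) ≤ d := by linarith
  have e4 : (m : ℝ) * (4 * d - 2) ≤ 5 * d ^ 2 := by
    have : (m : ℝ) * 4 / 5 - 2 * (m / (5 * d)) = (m * (4 * d - 2)) / (5 * d) := by
      have : (d : ℝ) ≠ 0 := by positivity
      field_simp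
    rw [this, div_le_iff₀ (by positivity)] at e3
    linarith
  rw [le_div_iff₀ (by linarith), hnm]
  push_cast
  -- Since `d ≥ 1`, `5 * d - 1 ≤ 5 * (4 * d - 2)`, so `e4` is stronger than the claim.
  nlinarith [mul_nonneg (Nat.cast_nonneg (α := ℝ) m) (sub_nonneg.2 hdR)]

end WallCycle

/-! ### Rewriting of edge paths -/

/-- Oriented edges with the squares that they span, subject to the conditions that hold in a
nonpositively curved cube complex. `Sq e e' g g'` says that the oriented edges `e`, `e'` span a
corner of a square, and that `e, g` and `e', g'` are the two halves of its boundary. -/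
structure SquareSystem (E : Type u) where
  inv : E → E
  inv_inv : ∀ e, inv (inv e) = e
  Sq : E → E → E → E → Prop
  symm : ∀ {e e' g g'}, Sq e e' g g' → Sq e' e g' g
  rot : ∀ {e e' g g'}, Sq e e' g g' → Sq (inv e) g e' (inv g')
  unique : ∀ {e e' g g' h h'}, Sq e e' g g' → Sq e e' h h' → g = h ∧ g' = h'
  irrefl : ∀ {e g g'}, ¬ Sq e e g g'
  cube : ∀ {a b c ab ba bc cb ac ca}, Sq a b ab ba → Sq b c bc cb → Sq a c ac ca →
    ∃ x y z, Sq ab ac x y ∧ Sq ba bc x z ∧ Sq ca cb y z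

namespace SquareSystem

variable {E : Type u} (T : SquareSystem E)

/-- Replacing one half of the boundary of a square by the other half. -/
inductive Step : List E → List E → Prop
  | flip {e e' g g' : E} (l : List E) : T.Sq e e' g g' → Step (e :: g :: l) (e' :: g' :: l)
  | cons (e : E) {p p' : List E} : Step p p' → Step (e :: p) (e :: p')

/-- Equivalence of edge paths under flips of squares. -/
def Eqv : List E → List E → Prop := Relation.ReflTransGen T.Step

variable {T}

theorem Step.symm {p q : List E} (h : T.Step p q) : T.Step q p := by
  induction h with
  | flip l h => exact .flip l (T.symm h)
  | cons e _ ih => exact .cons e ih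

theorem Step.length_eq {p q : List E} (h : T.Step p q) : p.length = q.length := by
  induction h with
  | flip l h => simp
  | cons e _ ih => simp [ih]

@[refl] theorem Eqv.refl (p : List E) : T.Eqv p p := Relation.ReflTransGen.refl

theorem Eqv.trans {p q r : List E} (h : T.Eqv p q) (h' : T.Eqv q r) : T.Eqv p r :=
  Relation.ReflTransGen.trans h h'

theorem Eqv.symm {p q : List E} (h : T.Eqv p q) : T.Eqv q p := by
  induction h with
  | refl => exact Relation.ReflTransGen.refl
  | tail _ h ih => exact Relation.ReflTransGen.head h.symm ih

theorem Eqv.length_eq {p q : List E} (h : T.Eqv p q) : p.length = q.length := by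
  induction h with
  | refl => rfl
  | tail _ h ih => exact ih.trans h.length_eq

theorem Eqv.cons (e : E) {p q : List E} (h : T.Eqv p q) : T.Eqv (e :: p) (e :: q) := by
  induction h with
  | refl => rfl
  | tail _ h ih => exact Relation.ReflTransGen.tail ih (.cons e h)

theorem Eqv.flip {e e' g g' : E} (l : List E) (h : T.Sq e e' g g') :
    T.Eqv (e :: g :: l) (e' :: g' :: l) := Relation.ReflTransGen.single (.flip l h)

theorem Sq_swap_inv {e e' g g' : E} (h : T.Sq e e' g g') : T.Sq (T.inv e') g' e (T.inv g) :=
  T.rot (T.symm h)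

theorem Sq_opposite {e e' g g' : E} (h : T.Sq e e' g g') :
    T.Sq (T.inv g) (T.inv g') (T.inv e) (T.inv e') := by
  have h1 := T.rot (T.symm (T.rot h))
  exact h1

/-- The outer induction is on length, the inner one on the number of flips. Only a flip of the first
two edges matters: it puts a second square next to the one already found, and the two are reconciled
at the vertex after `e₂`, where the remaining paths are shorter. -/
theorem exists_of_cons_eqv_aux (k : ℕ) : ∀ (p : List E), p.length = k → ∀ (e : E) (z : List E),
    T.Eqv (e :: p) z → ∃ e' p', z = e' :: p' ∧ ((e = e' ∧ T.Eqv p p') ∨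
      ∃ g g' q, T.Sq e e' g g' ∧ T.Eqv p (g :: q) ∧ T.Eqv p' (g' :: q)) := by
  induction k using Nat.strong_induction_on with
  | _ k ih =>
  intro p hp e z h
  induction h with
  | refl => exact ⟨e, p, rfl, Or.inl ⟨rfl, .refl _⟩⟩
  | tail _ hstep ih2 =>
    obtain ⟨e₂, p₂, rfl, H⟩ := ih2
    cases hstep with
    | cons _ h3 =>
      refine ⟨e₂, _, rfl, ?_⟩
      rcases H with ⟨rfl, h1⟩ | ⟨g, g', q, h1, h2, h4⟩
      · exact Or.inl ⟨rfl, Relation.ReflTransGen.tail h1 h3⟩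
      · exact Or.inr ⟨g, g', q, h1, h2, (Eqv.symm (Relation.ReflTransGen.single h3)).trans h4⟩
    | @flip _ e₃ g h l hsq =>
      refine ⟨e₃, _, rfl, ?_⟩
      rcases H with ⟨rfl, h1⟩ | ⟨g₁, g₂, q, h1, h2, h4⟩
      · exact Or.inr ⟨g, h, l, hsq, h1, .refl _⟩
      -- The tails `g₂ :: q` and `g :: l` start at the vertex after `e₂` and are equivalent, and `q`
      -- is shorter than `p`.
      · have hlen : q.length < k := by
          have := h2.length_eq
          simp only [List.length_cons] at this
          omega
        obtain ⟨_, _, heq, h5⟩ := ih _ hlen q rfl g₂ _ h4.symm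
        obtain ⟨rfl, rfl⟩ := List.cons.inj heq
        rcases h5 with ⟨rfl, h5⟩ | ⟨k₁, k₂, t, h5, h6, h7⟩
        · obtain ⟨h6, h7⟩ := T.unique (Sq_swap_inv h1) (T.rot hsq)
          have h8 : g₁ = h := by rw [← T.inv_inv g₁, h7, T.inv_inv]
          subst h8
          exact Or.inl ⟨h6, h2.trans (h5.cons _)⟩
        -- The edges back along `e₂`, `g₂` and `g` pairwise span squares, so the cube condition
        -- supplies the far faces; one of them is spanned by `e` and `e₃`.
        · obtain ⟨x, y, z, hx, hy, hz⟩ := T.cube (Sq_swap_inv h1) h5 (T.rot hsq)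
          have hx1 := T.rot hy
          have hz1 := T.rot hz
          rw [T.inv_inv] at hx1 hz1
          refine Or.inr ⟨x, y, T.inv z :: t, hx, ?_, ?_⟩
          · exact h2.trans ((h6.cons _).trans (Eqv.flip t hx1))
          · exact (h7.cons _).trans (Eqv.flip t hz1)

/-- Two equivalent paths have the same first edge, or their first edges span a square which both
paths may be assumed to traverse. -/
theorem eqv_cons_cons {e e' : E} {p p' : List E} (h : T.Eqv (e :: p) (e' :: p')) :
    (e = e' ∧ T.Eqv p p') ∨
      ∃ g g' q, T.Sq e e' g g' ∧ T.Eqv p (g :: q) ∧ T.Eqv p' (g' :: q) := by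
  obtain ⟨_, _, heq, h5⟩ := exists_of_cons_eqv_aux _ p rfl e _ h
  obtain ⟨rfl, rfl⟩ := List.cons.inj heq
  exact h5

theorem Eqv.cons_cancel {e : E} {p p' : List E} (h : T.Eqv (e :: p) (e :: p')) : T.Eqv p p' := by
  rcases eqv_cons_cons h with ⟨-, h⟩ | ⟨_, _, _, h, -⟩
  · exact h
  · exact absurd h T.irrefl

/-- If `e, e'` span a square, a path equivalent to paths with first edges `e` and `e'` may be
assumed to traverse it. -/
theorem exists_of_eqv_of_sq {e e' g g' : E} {p p' : List E} (hs : T.Sq e e' g g')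
    (h : T.Eqv (e :: p) (e' :: p')) : ∃ q, T.Eqv p (g :: q) ∧ T.Eqv p' (g' :: q) := by
  rcases eqv_cons_cons h with ⟨rfl, -⟩ | ⟨k, k', q, h1, h2, h3⟩
  · exact absurd hs T.irrefl
  · obtain ⟨rfl, rfl⟩ := T.unique hs h1
    exact ⟨q, h2, h3⟩

variable (T) in
/-- A path is reduced if no equivalent path has a backtrack. -/
def Red : List E → Prop
  | [] => True
  | e :: p => Red p ∧ ∀ q, ¬ T.Eqv p (T.inv e :: q)

/-- A backtrack appearing after the flip could be carried across the same square to a backtrack of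
the original path. -/
theorem Step.red {p q : List E} (h : T.Step p q) (hp : T.Red p) : T.Red q := by
  induction h with
  | cons e h ih =>
    exact ⟨ih hp.1, fun q hq => hp.2 q ((Relation.ReflTransGen.single h : T.Eqv _ _).trans hq)⟩
  | @flip e e' g g' l h =>
    obtain ⟨⟨h1, h2⟩, h3⟩ := hp
    refine ⟨⟨h1, fun q hq => ?_⟩, fun q hq => ?_⟩
    · refine h3 (e' :: q) ((hq.cons g).trans ?_)
      exact Eqv.flip q (T.symm (T.rot h))
    · obtain ⟨t, h4, -⟩ := exists_of_eqv_of_sq (T.symm (Sq_swap_inv h)) hq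
      exact h2 t h4

theorem Eqv.red {p q : List E} (h : T.Eqv p q) (hp : T.Red p) : T.Red q := by
  induction h with
  | refl => exact hp
  | tail _ h ih => exact h.red ih

open Classical in
variable (T) in
/-- Prepending an edge to a reduced path and reducing. -/
noncomputable def act (e : E) (p : List E) : List E :=
  if h : ∃ q, T.Eqv p (T.inv e :: q) then h.choose else e :: p

theorem act_of_eqv {e : E} {p q : List E} (h : T.Eqv p (T.inv e :: q)) : T.Eqv (T.act e p) q := by
  have hex : ∃ q, T.Eqv p (T.inv e :: q) := ⟨q, h⟩
  rw [act, dif_pos hex]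
  exact (hex.choose_spec.symm.trans h).cons_cancel

theorem act_of_not {e : E} {p : List E} (h : ∀ q, ¬ T.Eqv p (T.inv e :: q)) :
    T.act e p = e :: p := by
  rw [act, dif_neg (by simpa using h)]

theorem act_congr (e : E) {p p' : List E} (h : T.Eqv p p') :
    T.Eqv (T.act e p) (T.act e p') := by
  by_cases hex : ∃ q, T.Eqv p (T.inv e :: q)
  · obtain ⟨q, hq⟩ := hex
    exact (act_of_eqv hq).trans (act_of_eqv (h.symm.trans hq)).symm
  · push Not at hex
    rw [act_of_not hex, act_of_not fun q hq => hex q (h.trans hq)]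
    exact h.cons e

theorem act_red (e : E) {p : List E} (h : T.Red p) : T.Red (T.act e p) := by
  by_cases hex : ∃ q, T.Eqv p (T.inv e :: q)
  · obtain ⟨q, hq⟩ := hex
    exact (act_of_eqv hq).symm.red (hq.red h).1
  · push Not at hex
    rw [act_of_not hex]
    exact ⟨h, hex⟩

theorem act_inv (e : E) {p : List E} (h : T.Red p) : T.Eqv (T.act e (T.act (T.inv e) p)) p := by
  by_cases hex : ∃ q, T.Eqv p (T.inv (T.inv e) :: q)
  · obtain ⟨q, hq⟩ := hex
    refine (act_congr e (act_of_eqv hq)).trans ?_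
    rw [T.inv_inv] at hq
    rw [act_of_not (hq.red h).2]
    exact hq.symm
  · push Not at hex
    rw [act_of_not hex]
    exact act_of_eqv (.refl _)

/-- The cases are whether `p` first goes back along `g`, and then whether the result goes back along
`e`. In each case the square transports the cancellation, or its absence, to the other half of the
boundary. -/
theorem act_sq {e e' g g' : E} (h : T.Sq e e' g g') (p : List E) :
    T.Eqv (T.act e (T.act g p)) (T.act e' (T.act g' p)) := by
  have hopp := Sq_opposite h
  have hr := T.rot h
  have hr' := Sq_swap_inv h
  by_cases h1 : ∃ q, T.Eqv p (T.inv g :: q)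
  · obtain ⟨q, hq⟩ := h1
    refine (act_congr e (act_of_eqv hq)).trans ?_
    by_cases h2 : ∃ r, T.Eqv q (T.inv e :: r)
    · obtain ⟨r, hr⟩ := h2
      have h3 : T.Eqv p (T.inv g' :: T.inv e' :: r) :=
        hq.trans ((hr.cons _).trans (Eqv.flip r hopp))
      exact (act_of_eqv hr).trans
        ((act_congr e' (act_of_eqv h3)).trans (act_of_eqv (.refl _))).symm
    · push Not at h2
      rw [act_of_not h2]
      have h3 : ∀ q', ¬ T.Eqv p (T.inv g' :: q') := fun q' hq' => by
        obtain ⟨t, h4, -⟩ := exists_of_eqv_of_sq hopp (hq.symm.trans hq')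
        exact h2 t h4
      rw [act_of_not h3]
      have h4 : T.Eqv (g' :: p) (T.inv e' :: e :: q) :=
        (hq.cons g').trans (Eqv.flip q (T.symm hr'))
      exact (act_of_eqv h4).symm
  · push Not at h1
    rw [act_of_not h1]
    by_cases h2 : ∃ r, T.Eqv (g :: p) (T.inv e :: r)
    · obtain ⟨r, hr2⟩ := h2
      obtain ⟨t, h3, h4⟩ := exists_of_eqv_of_sq (T.symm hr) hr2
      refine (act_of_eqv hr2).trans (h4.trans ?_)
      refine Eqv.trans ?_ (act_congr e' (act_of_eqv h3)).symm
      rw [act_of_not]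
      intro q hq
      exact h1 _ (h3.trans ((hq.cons _).trans (Eqv.flip q (T.symm hopp))))
    · push Not at h2
      rw [act_of_not h2]
      have h3 : ∀ q', ¬ T.Eqv p (T.inv g' :: q') := fun q' hq' =>
        h2 _ ((hq'.cons g).trans (Eqv.flip q' (T.symm hr)))
      rw [act_of_not h3, act_of_not]
      · exact Eqv.flip p h
      · intro r hr2
        obtain ⟨t, h4, -⟩ := exists_of_eqv_of_sq (T.symm hr') hr2
        exact h1 _ h4

variable (T) in
/-- Reduction of the concatenation of a path with a reduced path. -/
noncomputable def reduce (l r : List E) : List E := l.foldr T.act r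

theorem reduce_append (l l' r : List E) :
    T.reduce (l ++ l') r = T.reduce l (T.reduce l' r) := List.foldr_append

@[simp] theorem reduce_nil (r : List E) : T.reduce [] r = r := rfl

@[simp] theorem reduce_cons (e : E) (l r : List E) :
    T.reduce (e :: l) r = T.act e (T.reduce l r) := rfl

theorem reduce_red (l : List E) {r : List E} (h : T.Red r) : T.Red (T.reduce l r) := by
  induction l with
  | nil => exact h
  | cons e l ih => exact act_red e ih

theorem reduce_congr (l : List E) {r r' : List E} (h : T.Eqv r r') :
    T.Eqv (T.reduce l r) (T.reduce l r') := by
  induction l with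
  | nil => exact h
  | cons e l ih => exact act_congr e ih

theorem reduce_of_red {l r : List E} (h : T.Red (l ++ r)) : T.Eqv (T.reduce l r) (l ++ r) := by
  induction l with
  | nil => exact .refl _
  | cons e l ih =>
    refine (act_congr e (ih h.1)).trans ?_
    rw [act_of_not (p := l ++ r) h.2]
    exact .refl _

variable (T) in
/-- Elementary homotopies of edge paths. -/
inductive Homotopy : List E → List E → Prop
  | backtrack (l₁ l₂ : List E) (e : E) : Homotopy (l₁ ++ [e, T.inv e] ++ l₂) (l₁ ++ l₂)
  | square (l₁ l₂ : List E) {e e' g g' : E} (h : T.Sq e e' g g') :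
      Homotopy (l₁ ++ [e, g] ++ l₂) (l₁ ++ [e', g'] ++ l₂)

theorem Homotopy.reduce {l l' : List E} (h : T.Homotopy l l') {r : List E} (hr : T.Red r) :
    T.Eqv (T.reduce l r) (T.reduce l' r) := by
  cases h with
  | backtrack l₁ l₂ e =>
    simp only [reduce_append, reduce_cons, reduce_nil]
    exact reduce_congr _ (act_inv e (reduce_red _ hr))
  | square l₁ l₂ h =>
    simp only [reduce_append, reduce_cons, reduce_nil]
    exact reduce_congr _ (act_sq h _)

variable (T) in
/-- The reversed path. -/
def rev (l : List E) : List E := (l.map T.inv).reverse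

@[simp] theorem rev_nil : T.rev [] = [] := rfl

@[simp] theorem rev_cons (e : E) (l : List E) : T.rev (e :: l) = T.rev l ++ [T.inv e] := by
  simp [rev]

@[simp] theorem length_rev (l : List E) : (T.rev l).length = l.length := by simp [rev]

theorem reduce_rev_reduce (l : List E) {r : List E} (hr : T.Red r) :
    T.Eqv (T.reduce (T.rev l) (T.reduce l r)) r := by
  induction l with
  | nil => exact .refl _
  | cons e l ih =>
    rw [rev_cons, reduce_append]
    refine (reduce_congr _ ?_).trans ih
    have := act_inv (T.inv e) (reduce_red l hr)
    rwa [T.inv_inv] at this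

/-- If the concatenation of two reduced paths is not reduced, then, up to equivalence, the first
one ends with an edge which the second one traverses back. -/
theorem exists_common_edge {p₁ : List E} : ∀ {p₂ : List E}, T.Red p₁ → T.Red p₂ →
    (T.reduce (T.rev p₁) p₂).length < p₁.length + p₂.length →
    ∃ e r t, T.Eqv p₁ (e :: r) ∧ T.Eqv p₂ (e :: t) := by
  induction p₁ with
  | nil => intro p₂ _ _ h; simp at h
  | cons e p ih =>
    intro p₂ h1 h2 hl
    by_cases hex : ∃ t, T.Eqv p₂ (e :: t)
    · obtain ⟨t, ht⟩ := hex
      exact ⟨e, p, t, .refl _, ht⟩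
    · push Not at hex
      have hact : T.act (T.inv e) p₂ = T.inv e :: p₂ := act_of_not (by rwa [T.inv_inv])
      rw [rev_cons, reduce_append, reduce_cons, reduce_nil, hact] at hl
      have hred : T.Red (T.inv e :: p₂) := hact ▸ act_red _ h2
      -- The induction compares `p` with `T.inv e :: p₂`. The common first edge `f` is not `T.inv
      -- e`, since `e :: p` is reduced, so the two span a square; the edge opposite to `f` then
      -- begins both `e :: p` and `p₂` up to equivalence.
      obtain ⟨f, r, t, h3, h4⟩ := ih h1.1 hred (by simp only [List.length_cons] at hl ⊢; omega)
      rcases eqv_cons_cons h4 with ⟨rfl, -⟩ | ⟨g, g', q, hs, h5, -⟩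
      · exact absurd h3 (h1.2 r)
      · have hs' := T.rot hs
        rw [T.inv_inv] at hs'
        exact ⟨g, _, q, (h3.cons e).trans (Eqv.flip r hs'), h5⟩

end SquareSystem

/-! ### The square system of a nonpositively curved cube complex -/

namespace CubeFace

theorem comp_edge {m n : ℕ} (f : CubeFace m n) (x : Fin m → Bool) (i : Fin m) :
    f.comp (edge x i) = edge (f.apply x) (f.dir i) := by
  ext j
  · rfl
  · rfl

theorem apply_false {m n : ℕ} (f : CubeFace m n) : f.apply (fun _ => false) = f.base := by
  funext j
  simp [apply]

theorem flip_comp_flip : flip.comp flip = CubeFace.id 1 := by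
  ext j
  · obtain rfl : j = 0 := Subsingleton.elim _ _
    decide
  · rfl

end CubeFace

namespace CubeComplex

variable (X : CubeComplex.{u})

theorem edgeAt_restrict {m n : ℕ} (f : CubeFace m n) (c : X.Cell n) (x : Fin m → Bool)
    (i : Fin m) : X.edgeAt (X.restrict f c) x i = X.edgeAt c (f.apply x) (f.dir i) := by
  rw [edgeAt, X.restrict_comp, CubeFace.comp_edge, edgeAt]

theorem vertexAt_restrict {m n : ℕ} (f : CubeFace m n) (c : X.Cell n) (x : Fin m → Bool) :
    X.vertexAt (X.restrict f c) x = X.vertexAt c (f.apply x) := by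
  rw [vertexAt, X.restrict_comp, CubeFace.comp_corner, vertexAt]

theorem src_edgeAt {n : ℕ} (c : X.Cell n) (x : Fin n → Bool) (i : Fin n) :
    X.src (X.edgeAt c x i) = X.vertexAt c x := by
  rw [src, edgeAt, vertexAt_restrict, CubeFace.apply_false]
  rfl

theorem inv_edgeAt {n : ℕ} (c : X.Cell n) (x : Fin n → Bool) (i : Fin n) :
    X.inv (X.edgeAt c x i) = X.edgeAt c ((CubeFace.edge x i).apply fun _ => true) i := by
  rw [inv, edgeAt, X.restrict_comp, edgeAt]
  congr 1

theorem inv_inv (e : X.Cell 1) : X.inv (X.inv e) = e := by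
  rw [inv, inv, X.restrict_comp, CubeFace.flip_comp_flip, X.restrict_id]

/-- The oriented edges `e`, `e'` span a corner of a square whose boundary has the halves `e, g` and
`e', g'`. -/
def IsSquare (e e' g g' : X.Cell 1) : Prop :=
  ∃ s : X.Cell 2, X.edgeAt s (fun _ => false) 0 = e ∧ X.edgeAt s (fun _ => false) 1 = e' ∧
    X.edgeAt s ![true, false] 1 = g ∧ X.edgeAt s ![false, true] 0 = g'

variable {X}

theorem isSquare_face {n : ℕ} (c : X.Cell n) (f : CubeFace 2 n) :
    X.IsSquare (X.edgeAt c f.base (f.dir 0)) (X.edgeAt c f.base (f.dir 1))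
      (X.edgeAt c (f.apply ![true, false]) (f.dir 1))
      (X.edgeAt c (f.apply ![false, true]) (f.dir 0)) := by
  refine ⟨X.restrict f c, ?_, ?_, ?_, ?_⟩
  · rw [edgeAt_restrict, CubeFace.apply_false]
  · rw [edgeAt_restrict, CubeFace.apply_false]
  · rw [edgeAt_restrict]
  · rw [edgeAt_restrict]

theorem IsSquare.symm {e e' g g' : X.Cell 1} (h : X.IsSquare e e' g g') :
    X.IsSquare e' e g' g := by
  obtain ⟨s, rfl, rfl, rfl, rfl⟩ := h
  have := isSquare_face s ⟨fun _ => false, ⟨![1, 0], by decide⟩⟩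
  convert this using 2 <;> decide

theorem IsSquare.rot {e e' g g' : X.Cell 1} (h : X.IsSquare e e' g g') :
    X.IsSquare (X.inv e) g e' (X.inv g') := by
  obtain ⟨s, rfl, rfl, rfl, rfl⟩ := h
  have := isSquare_face s ⟨![true, false], Function.Embedding.refl _⟩
  rw [inv_edgeAt, inv_edgeAt]
  convert this using 2 <;> decide

theorem IsSquare.src_eq {e e' g g' : X.Cell 1} (h : X.IsSquare e e' g g') :
    X.src e = X.src e' := by
  obtain ⟨s, rfl, rfl, rfl, rfl⟩ := h
  rw [src_edgeAt, src_edgeAt]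

theorem IsSquare.src_left {e e' g g' : X.Cell 1} (h : X.IsSquare e e' g g') :
    X.src g = X.tgt e := by
  rw [← X.src_inv, h.rot.src_eq]

theorem IsSquare.src_right {e e' g g' : X.Cell 1} (h : X.IsSquare e e' g g') :
    X.src g' = X.tgt e' := h.symm.src_left

theorem IsSquare.tgt_eq {e e' g g' : X.Cell 1} (h : X.IsSquare e e' g g') :
    X.tgt g = X.tgt g' := by
  have := h.rot.src_right
  rw [X.src_inv] at this
  exact this.symm

theorem IsNonpositivelyCurved.cell_eq (hX : X.IsNonpositivelyCurved) {n : ℕ} (c c' : X.Cell (n + 1))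
    (h : ∀ i, X.edgeAt c (fun _ => false) i = X.edgeAt c' (fun _ => false) i) : c = c' := by
  refine hX.eq_of_edges_eq c c' ?_ h
  rw [← src_edgeAt X c _ 0, ← src_edgeAt X c' _ 0, h]

theorem IsNonpositivelyCurved.isSquare_unique (hX : X.IsNonpositivelyCurved)
    {e e' g g' h h' : X.Cell 1} (h1 : X.IsSquare e e' g g') (h2 : X.IsSquare e e' h h') :
    g = h ∧ g' = h' := by
  obtain ⟨s, rfl, rfl, rfl, rfl⟩ := h1
  obtain ⟨t, h3, h4, rfl, rfl⟩ := h2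
  have : t = s := hX.cell_eq t s fun i => by
    fin_cases i
    · exact h3
    · exact h4
  subst this
  exact ⟨rfl, rfl⟩

theorem IsNonpositivelyCurved.isSquare_irrefl (hX : X.IsNonpositivelyCurved) {e g g' : X.Cell 1} :
    ¬ X.IsSquare e e g g' := by
  rintro ⟨s, h1, h2, -⟩
  exact absurd (hX.edges_injective s (h1.trans h2.symm)) (by decide)

theorem IsNonpositivelyCurved.isSquare_cube (hX : X.IsNonpositivelyCurved)
    {a b c ab ba bc cb ac ca : X.Cell 1} (hab : X.IsSquare a b ab ba) (hbc : X.IsSquare b c bc cb)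
    (hac : X.IsSquare a c ac ca) :
    ∃ x y z, X.IsSquare ab ac x y ∧ X.IsSquare ba bc x z ∧ X.IsSquare ca cb y z := by
  have key : ∀ {e e' g g' : X.Cell 1}, X.IsSquare e e' g g' → ∃ s : X.Cell 2,
      X.edgeAt s (fun _ => false) 0 = e ∧ X.edgeAt s (fun _ => false) 1 = e' :=
    fun ⟨s, h1, h2, _⟩ => ⟨s, h1, h2⟩
  -- Flagness fills the corner with a 3-cube. Since squares are determined by their corners, the
  -- given ones are its faces at that corner, and the three opposite faces are those required.
  obtain ⟨q, -, hq⟩ := hX.flag (X.src a) ![a, b, c]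
    (by
      intro i
      fin_cases i
      · rfl
      · exact hab.src_eq.symm
      · exact hac.src_eq.symm)
    (by
      intro i j hij
      fin_cases i <;> fin_cases j
      · exact absurd rfl hij
      · exact key hab
      · exact key hac
      · exact key hab.symm
      · exact absurd rfl hij
      · exact key hbc
      · exact key hac.symm
      · exact key hbc.symm
      · exact absurd rfl hij)
  have q0 : X.edgeAt q (fun _ => false) 0 = a := hq 0
  have q1 : X.edgeAt q (fun _ => false) 1 = b := hq 1
  have q2 : X.edgeAt q (fun _ => false) 2 = c := hq 2
  have hab' : X.IsSquare a b (X.edgeAt q ![true, false, false] 1)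
      (X.edgeAt q ![false, true, false] 0) := by
    have := isSquare_face q ⟨fun _ => false, ⟨![0, 1], by decide⟩⟩
    rw [← q0, ← q1]
    convert this using 2 <;> decide
  have hbc' : X.IsSquare b c (X.edgeAt q ![false, true, false] 2)
      (X.edgeAt q ![false, false, true] 1) := by
    have := isSquare_face q ⟨fun _ => false, ⟨![1, 2], by decide⟩⟩
    rw [← q1, ← q2]
    convert this using 2 <;> decide
  have hac' : X.IsSquare a c (X.edgeAt q ![true, false, false] 2)
      (X.edgeAt q ![false, false, true] 0) := by
    have := isSquare_face q ⟨fun _ => false, ⟨![0, 2], by decide⟩⟩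
    rw [← q0, ← q2]
    convert this using 2 <;> decide
  obtain ⟨rfl, rfl⟩ := hX.isSquare_unique hab hab'
  obtain ⟨rfl, rfl⟩ := hX.isSquare_unique hbc hbc'
  obtain ⟨rfl, rfl⟩ := hX.isSquare_unique hac hac'
  refine ⟨X.edgeAt q ![true, true, false] 2, X.edgeAt q ![true, false, true] 1,
    X.edgeAt q ![false, true, true] 0, ?_, ?_, ?_⟩
  · have := isSquare_face q ⟨![true, false, false], ⟨![1, 2], by decide⟩⟩
    convert this using 2 <;> decide
  · have := isSquare_face q ⟨![false, true, false], ⟨![0, 2], by decide⟩⟩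
    convert this using 2 <;> decide
  · have := isSquare_face q ⟨![false, false, true], ⟨![0, 1], by decide⟩⟩
    convert this using 2 <;> decide

/-- The squares of a nonpositively curved cube complex. -/
def IsNonpositivelyCurved.squares (hX : X.IsNonpositivelyCurved) : SquareSystem (X.Cell 1) where
  inv := X.inv
  inv_inv := X.inv_inv
  Sq := X.IsSquare
  symm := IsSquare.symm
  rot := IsSquare.rot
  unique := hX.isSquare_unique
  irrefl := hX.isSquare_irrefl
  cube := hX.isSquare_cube

theorem IsNonpositivelyCurved.homotopy (hX : X.IsNonpositivelyCurved) {l l' : List (X.Cell 1)}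
    (h : X.ElementaryHomotopy l l') : hX.squares.Homotopy l l' := by
  have h0 : (![false, false] : Fin 2 → Bool) = fun _ => false := by decide
  cases h with
  | backtrack l₁ l₂ e => exact .backtrack l₁ l₂ e
  | square l₁ l₂ s =>
    rw [h0]
    exact .square (T := hX.squares) l₁ l₂ ⟨s, rfl, rfl, rfl, rfl⟩

/-! ### Edge paths -/

theorem isEdgePath_append {a b c : X.Cell 0} {l l' : List (X.Cell 1)} (h : X.IsEdgePath a b l)
    (h' : X.IsEdgePath b c l') : X.IsEdgePath a c (l ++ l') := by
  induction l generalizing a with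
  | nil => obtain rfl : a = b := h; exact h'
  | cons e l ih => exact ⟨h.1, ih h.2⟩

theorem exists_of_isEdgePath_append {a c : X.Cell 0} {l l' : List (X.Cell 1)}
    (h : X.IsEdgePath a c (l ++ l')) : ∃ b, X.IsEdgePath a b l ∧ X.IsEdgePath b c l' := by
  induction l generalizing a with
  | nil => exact ⟨a, rfl, h⟩
  | cons e l ih =>
    obtain ⟨b, h1, h2⟩ := ih h.2
    exact ⟨b, ⟨h.1, h1⟩, h2⟩

theorem IsEdgePath.rev (hX : X.IsNonpositivelyCurved) {a b : X.Cell 0} {l : List (X.Cell 1)}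
    (h : X.IsEdgePath a b l) : X.IsEdgePath b a (hX.squares.rev l) := by
  induction l generalizing a with
  | nil => exact Eq.symm h
  | cons e l ih =>
    rw [SquareSystem.rev_cons]
    exact isEdgePath_append (ih h.2) ⟨X.src_inv e, (X.tgt_inv e).trans h.1⟩

variable {hX : X.IsNonpositivelyCurved}

theorem IsEdgePath.of_step {l l' : List (X.Cell 1)} (hs : hX.squares.Step l l') {a b : X.Cell 0}
    (h : X.IsEdgePath a b l) : X.IsEdgePath a b l' := by
  induction hs generalizing a with
  | cons e _ ih => exact ⟨h.1, ih h.2⟩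
  | flip l hsq =>
    have hsq : X.IsSquare _ _ _ _ := hsq
    exact ⟨hsq.src_eq.symm.trans h.1, hsq.src_right, hsq.tgt_eq ▸ h.2.2⟩

theorem IsEdgePath.of_eqv {l l' : List (X.Cell 1)} (hs : hX.squares.Eqv l l') {a b : X.Cell 0}
    (h : X.IsEdgePath a b l) : X.IsEdgePath a b l' := by
  induction hs with
  | refl => exact h
  | tail _ hs ih => exact ih.of_step hs

theorem IsEdgePath.act {l : List (X.Cell 1)} {e : X.Cell 1} {b : X.Cell 0}
    (h : X.IsEdgePath (X.tgt e) b l) : X.IsEdgePath (X.src e) b (hX.squares.act e l) := by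
  by_cases hex : ∃ q, hX.squares.Eqv l (X.inv e :: q)
  · obtain ⟨q, hq⟩ := hex
    refine IsEdgePath.of_eqv (SquareSystem.act_of_eqv hq).symm ?_
    have := (h.of_eqv hq).2
    rwa [X.tgt_inv] at this
  · push Not at hex
    rw [SquareSystem.act_of_not hex]
    exact ⟨rfl, h⟩

theorem IsEdgePath.reduce {l : List (X.Cell 1)} {a b : X.Cell 0} (h : X.IsEdgePath a b l) :
    X.IsEdgePath a b (hX.squares.reduce l []) := by
  induction l generalizing a with
  | nil => exact h
  | cons e l ih =>
    obtain ⟨rfl, h⟩ := h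
    exact (ih h).act

end CubeComplex

/-! ### Lengths of reductions -/

namespace SquareSystem

variable {E : Type u} {T : SquareSystem E}

theorem Step.append_right {p q : List E} (h : T.Step p q) (r : List E) :
    T.Step (p ++ r) (q ++ r) := by
  induction h with
  | flip l h => exact .flip (l ++ r) h
  | cons e _ ih => exact .cons e ih

theorem Eqv.append_right {p q : List E} (h : T.Eqv p q) (r : List E) :
    T.Eqv (p ++ r) (q ++ r) := by
  induction h with
  | refl => rfl
  | tail _ h ih =>
    exact ih.trans (Relation.ReflTransGen.single (h.append_right r))

theorem Red.of_append {p q : List E} (h : T.Red (p ++ q)) : T.Red p := by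
  induction p with
  | nil => trivial
  | cons e p ih => exact ⟨ih h.1, fun r hr => h.2 (r ++ q) (hr.append_right q)⟩

theorem length_act (e : E) (p : List E) :
    (T.act e p).length = p.length + 1 ∧ (∀ q, ¬ T.Eqv p (T.inv e :: q)) ∨
      (T.act e p).length + 1 = p.length := by
  by_cases hex : ∃ q, T.Eqv p (T.inv e :: q)
  · obtain ⟨q, hq⟩ := hex
    right
    rw [(act_of_eqv hq).length_eq, hq.length_eq, List.length_cons]
  · push Not at hex
    left
    rw [act_of_not hex]
    exact ⟨rfl, hex⟩

theorem length_reduce_le (l r : List E) : (T.reduce l r).length ≤ l.length + r.length := by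
  induction l with
  | nil => simp
  | cons e l ih =>
    rw [reduce_cons, List.length_cons]
    rcases length_act (T := T) e (T.reduce l r) with h | h <;> omega

theorem length_reduce_mod_two (l r : List E) :
    (T.reduce l r).length % 2 = (l.length + r.length) % 2 := by
  induction l with
  | nil => simp
  | cons e l ih =>
    rw [reduce_cons, List.length_cons]
    rcases length_act (T := T) e (T.reduce l r) with h | h <;> omega

/-- Each prepended edge either lengthens the path or cancels; full length means that nothing was
cancelled. -/
theorem red_of_length_reduce {l : List E} (h : (T.reduce l []).length = l.length) : T.Red l := by
  induction l with
  | nil => trivial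
  | cons e l ih =>
    rw [reduce_cons, List.length_cons] at h
    have h1 := length_reduce_le (T := T) l []
    rw [List.length_nil] at h1
    rcases length_act (T := T) e (T.reduce l []) with ⟨h2, h3⟩ | h2
    · have hl := ih (by omega)
      have h4 : T.Eqv (T.reduce l []) l := by
        simpa using reduce_of_red (T := T) (l := l) (r := []) (by simpa using hl)
      exact ⟨hl, fun q hq => h3 q (h4.trans hq)⟩
    · omega

theorem reduce_eqv_of_red {l : List E} (h : T.Red l) : T.Eqv (T.reduce l []) l := by
  simpa using reduce_of_red (T := T) (l := l) (r := []) (by simpa using h)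

end SquareSystem

namespace CubeComplex

variable {X : CubeComplex.{u}}

/-! ### Geodesics -/

namespace IsCAT0

/-- The squares of a `CAT(0)` cube complex. -/
abbrev squares (hX : X.IsCAT0) : SquareSystem (X.Cell 1) := hX.nonpositivelyCurved.squares

theorem reduce_closed (hX : X.IsCAT0) {a : X.Cell 0} {l : List (X.Cell 1)}
    (hl : X.IsEdgePath a a l) {r : List (X.Cell 1)} (hr : hX.squares.Red r) :
    hX.squares.Eqv (hX.squares.reduce l r) r := by
  have key : ∀ p q : {l // X.IsEdgePath a a l},
      Relation.EqvGen (fun q r : {l // X.IsEdgePath a a l} => X.ElementaryHomotopy q.1 r.1) p q →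
      hX.squares.Eqv (hX.squares.reduce p.1 r) (hX.squares.reduce q.1 r) := by
    intro p q h
    induction h with
    | rel p q h => exact (hX.nonpositivelyCurved.homotopy h).reduce hr
    | refl p => exact .refl _
    | symm p q _ ih => exact ih.symm
    | trans p q r _ _ ih ih' => exact ih.trans ih'
  exact key ⟨l, hl⟩ ⟨[], rfl⟩ (hX.simplyConnected.nullhomotopic a ⟨l, hl⟩)

/-- The closed path `p` followed by the reverse of `q` acts trivially on the reduction of `q`, while
the reverse of `q` cancels that reduction, leaving the reduction of `p`. -/
theorem reduce_eqv_reduce (hX : X.IsCAT0) {a b : X.Cell 0} {p q : List (X.Cell 1)}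
    (hp : X.IsEdgePath a b p) (hq : X.IsEdgePath a b q) :
    hX.squares.Eqv (hX.squares.reduce p []) (hX.squares.reduce q []) := by
  have hr : hX.squares.Red (hX.squares.reduce q []) := SquareSystem.reduce_red q trivial
  have h1 := hX.reduce_closed (isEdgePath_append hp (hq.rev hX.nonpositivelyCurved)) hr
  rw [SquareSystem.reduce_append] at h1
  exact (SquareSystem.reduce_congr p
    (SquareSystem.reduce_rev_reduce q (r := []) trivial)).symm.trans h1

/-- A geodesic edge path between two vertices. -/
noncomputable def geod (hX : X.IsCAT0) (a b : X.Cell 0) : List (X.Cell 1) :=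
  hX.squares.reduce (hX.simplyConnected.connected a b).choose []

/-- The combinatorial distance of two vertices. -/
noncomputable def edist (hX : X.IsCAT0) (a b : X.Cell 0) : ℕ := (hX.geod a b).length

variable (hX : X.IsCAT0)

theorem geod_path (a b : X.Cell 0) : X.IsEdgePath a b (hX.geod a b) :=
  (hX.simplyConnected.connected a b).choose_spec.reduce

theorem geod_red (a b : X.Cell 0) : hX.squares.Red (hX.geod a b) :=
  SquareSystem.reduce_red _ trivial

theorem reduce_eqv_geod {a b : X.Cell 0} {p : List (X.Cell 1)} (hp : X.IsEdgePath a b p) :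
    hX.squares.Eqv (hX.squares.reduce p []) (hX.geod a b) :=
  hX.reduce_eqv_reduce hp (hX.simplyConnected.connected a b).choose_spec

theorem eqv_geod {a b : X.Cell 0} {p : List (X.Cell 1)} (hp : X.IsEdgePath a b p)
    (hr : hX.squares.Red p) : hX.squares.Eqv p (hX.geod a b) :=
  (SquareSystem.reduce_eqv_of_red hr).symm.trans (hX.reduce_eqv_geod hp)

theorem length_eq_edist {a b : X.Cell 0} {p : List (X.Cell 1)} (hp : X.IsEdgePath a b p)
    (hr : hX.squares.Red p) : p.length = hX.edist a b :=
  (hX.eqv_geod hp hr).length_eq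

theorem edist_le {a b : X.Cell 0} {p : List (X.Cell 1)} (hp : X.IsEdgePath a b p) :
    hX.edist a b ≤ p.length := by
  have h := SquareSystem.length_reduce_le (T := hX.squares) p []
  rwa [(hX.reduce_eqv_geod hp).length_eq] at h

theorem length_mod_two {a b : X.Cell 0} {p : List (X.Cell 1)} (hp : X.IsEdgePath a b p) :
    hX.edist a b % 2 = p.length % 2 := by
  have h := SquareSystem.length_reduce_mod_two (T := hX.squares) p []
  rwa [(hX.reduce_eqv_geod hp).length_eq] at h

theorem red_of_length_le {a b : X.Cell 0} {p : List (X.Cell 1)} (hp : X.IsEdgePath a b p)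
    (h : p.length ≤ hX.edist a b) : hX.squares.Red p :=
  SquareSystem.red_of_length_reduce <|
    (hX.reduce_eqv_geod hp).length_eq.trans ((hX.edist_le hp).antisymm h)

theorem edist_self (a : X.Cell 0) : hX.edist a a = 0 :=
  Nat.le_zero.1 (hX.edist_le (p := []) rfl)

theorem edist_comm (a b : X.Cell 0) : hX.edist a b = hX.edist b a := by
  apply le_antisymm
  · have h := hX.edist_le ((hX.geod_path b a).rev hX.nonpositivelyCurved)
    rwa [SquareSystem.length_rev] at h
  · have h := hX.edist_le ((hX.geod_path a b).rev hX.nonpositivelyCurved)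
    rwa [SquareSystem.length_rev] at h

theorem edist_triangle (a b c : X.Cell 0) : hX.edist a c ≤ hX.edist a b + hX.edist b c := by
  have h := hX.edist_le (isEdgePath_append (hX.geod_path a b) (hX.geod_path b c))
  rwa [List.length_append] at h

/-- Cancellation preserves parity, so the distances differ by an odd number, and by at most one. -/
theorem edist_edge (e : X.Cell 1) (x : X.Cell 0) :
    hX.edist (X.tgt e) x + 1 = hX.edist (X.src e) x ∨
      hX.edist (X.tgt e) x = hX.edist (X.src e) x + 1 := by
  have hp : X.IsEdgePath (X.src e) x (e :: hX.geod (X.tgt e) x) := ⟨rfl, hX.geod_path _ _⟩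
  have h1 := hX.edist_le hp
  have h2 := hX.length_mod_two hp
  have hq : X.IsEdgePath (X.tgt e) x (X.inv e :: hX.geod (X.src e) x) :=
    ⟨X.src_inv e, (X.tgt_inv e).symm ▸ hX.geod_path _ _⟩
  have h3 := hX.edist_le hq
  rw [List.length_cons] at h1 h2 h3
  change _ ≤ hX.edist _ _ + 1 at h1
  change _ ≤ hX.edist _ _ + 1 at h3
  change _ = (hX.edist _ _ + 1) % 2 at h2
  omega

/-- The oriented edge `e` points towards `x`. -/
def Desc (e : X.Cell 1) (x : X.Cell 0) : Prop := hX.edist (X.tgt e) x < hX.edist (X.src e) x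

theorem desc_inv (e : X.Cell 1) (x : X.Cell 0) : hX.Desc (X.inv e) x ↔ ¬ hX.Desc e x := by
  rw [Desc, Desc, X.tgt_inv, X.src_inv]
  have := hX.edist_edge e x
  omega

theorem desc_tgt (e : X.Cell 1) : hX.Desc e (X.tgt e) := by
  rw [Desc, hX.edist_self]
  have := hX.edist_edge e (X.tgt e)
  rw [hX.edist_self] at this
  omega

theorem not_desc_src (e : X.Cell 1) : ¬ hX.Desc e (X.src e) := by
  rw [Desc, hX.edist_self]
  omega

theorem Desc.red {hX : X.IsCAT0} {e : X.Cell 1} {x : X.Cell 0} (h : hX.Desc e x) :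
    hX.squares.Red (e :: hX.geod (X.tgt e) x) := by
  refine hX.red_of_length_le ⟨rfl, hX.geod_path _ _⟩ ?_
  rw [List.length_cons]
  exact h

theorem Desc.eqv {hX : X.IsCAT0} {e : X.Cell 1} {x : X.Cell 0} (h : hX.Desc e x) :
    hX.squares.Eqv (e :: hX.geod (X.tgt e) x) (hX.geod (X.src e) x) :=
  hX.eqv_geod ⟨rfl, hX.geod_path _ _⟩ h.red

theorem desc_of_red {e : X.Cell 1} {x : X.Cell 0} {p : List (X.Cell 1)}
    (hp : X.IsEdgePath (X.tgt e) x p) (hr : hX.squares.Red (e :: p)) : hX.Desc e x := by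
  have h1 := hX.length_eq_edist (show X.IsEdgePath (X.src e) x (e :: p) from ⟨rfl, hp⟩) hr
  have h2 := hX.edist_le hp
  rw [List.length_cons] at h1
  rw [Desc]
  omega

theorem desc_of_eqv {a x : X.Cell 0} {e : X.Cell 1} {p : List (X.Cell 1)}
    (h : hX.squares.Eqv (hX.geod a x) (e :: p)) : X.src e = a ∧ hX.Desc e x :=
  have hp := (hX.geod_path a x).of_eqv h
  ⟨hp.1, hX.desc_of_red hp.2 (h.red (hX.geod_red a x))⟩

theorem hasSimplicialSkeleton (hX : X.IsCAT0) : X.HasSimplicialSkeleton where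
  no_loop := by
    intro e h
    have := hX.desc_tgt e
    rw [Desc, h] at this
    exact lt_irrefl _ this
  no_multiple := by
    intro e e' h h'
    have h1 := (hX.desc_tgt e).eqv
    have h2 := (hX.desc_tgt e').eqv
    have h0 : hX.geod (X.tgt e) (X.tgt e) = [] := List.length_eq_zero_iff.1 (hX.edist_self _)
    have h0' : hX.geod (X.tgt e') (X.tgt e') = [] := List.length_eq_zero_iff.1 (hX.edist_self _)
    rw [h0] at h1
    rw [h0', ← h, ← h'] at h2
    rcases SquareSystem.eqv_cons_cons (h1.trans h2.symm) with ⟨h3, -⟩ | ⟨g, g', q, -, h3, -⟩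
    · exact h3
    · exact absurd h3.length_eq (by simp)

/-- Two edges at a vertex which point towards a common vertex span a square. -/
theorem isSquare_of_desc {e f : X.Cell 1} {x : X.Cell 0} (hsrc : X.src e = X.src f) (hne : e ≠ f)
    (he : hX.Desc e x) (hf : hX.Desc f x) : ∃ g g' q, X.IsSquare e f g g' ∧
      hX.squares.Eqv (hX.geod (X.tgt e) x) (g :: q) := by
  have h1 := he.eqv
  rw [hsrc] at h1
  rcases SquareSystem.eqv_cons_cons (h1.trans hf.eqv.symm) with ⟨h3, -⟩ | ⟨g, g', q, h2, h3, -⟩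
  · exact absurd h3 hne
  · exact ⟨g, g', q, h2, h3⟩

/-- Were `g'` to point away from `x`, the distances around the square would force `e` and `e'` both
to point towards `x`. The square at their corner then continues geodesically to its far vertex,
which is too close to `x` for that. -/
theorem desc_opposite {e e' g g' : X.Cell 1} (h : X.IsSquare e e' g g') {x : X.Cell 0}
    (he : hX.Desc e x) : hX.Desc g' x := by
  by_contra hg
  have hs := h.src_eq
  have h1 := h.src_left
  have h2 := h.src_right
  have h3 := h.tgt_eq
  have k1 := hX.edist_edge e x
  have k2 := hX.edist_edge e' x
  have k3 := hX.edist_edge g x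
  have k4 := hX.edist_edge g' x
  rw [Desc] at he hg
  rw [← hs] at k2
  rw [h1, h3] at k3
  rw [h2] at k4 hg
  have he' : hX.Desc e' x := by
    rw [Desc, ← hs]
    omega
  have hne : e ≠ e' := fun hee => hX.nonpositivelyCurved.isSquare_irrefl (hee ▸ h)
  obtain ⟨k, k', q, hsq, hq⟩ := hX.isSquare_of_desc hs hne he he'
  obtain ⟨rfl, rfl⟩ := hX.nonpositivelyCurved.isSquare_unique h hsq
  have hd := (hX.desc_of_eqv hq).2
  rw [Desc, h1, h3] at hd
  omega

theorem desc_opposite_iff {e e' g g' : X.Cell 1} (h : X.IsSquare e e' g g') (x : X.Cell 0) :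
    hX.Desc e x ↔ hX.Desc g' x := by
  refine ⟨hX.desc_opposite h, fun hg => ?_⟩
  by_contra he
  rw [← hX.desc_inv] at he
  have := hX.desc_opposite h.rot he
  rw [hX.desc_inv] at this
  exact this hg

end IsCAT0

/-! ### Walls -/

variable (X) in
/-- Two oriented edges are elementarily parallel if they are opposite edges of a square, or inverse
to each other. -/
def Parallel (e f : X.Cell 1) : Prop := f = X.inv e ∨ ∃ e' g, X.IsSquare e e' g f

variable (X) in
/-- The walls (hyperplanes) of a cube complex. -/
def Wall : Type u := Quot X.Parallel

/-- The wall dual to an edge. -/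
def wall (e : X.Cell 1) : X.Wall := Quot.mk _ e

theorem wall_inv (e : X.Cell 1) : wall (X.inv e) = wall e :=
  (Quot.sound (r := X.Parallel) (Or.inl rfl)).symm

theorem IsSquare.wall_eq {e e' g g' : X.Cell 1} (h : X.IsSquare e e' g g') : wall e = wall g' :=
  Quot.sound (Or.inr ⟨e', g, h⟩)

theorem IsSquare.wall_eq' {e e' g g' : X.Cell 1} (h : X.IsSquare e e' g g') : wall e' = wall g :=
  h.symm.wall_eq

/-- Transitivity also receives an equality of walls, so that `r` may carry hypotheses about the wall
of its first edge. -/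
theorem wall_induction {r : X.Cell 1 → X.Cell 1 → Prop} (hrefl : ∀ e, r e e)
    (hsymm : ∀ e f, r e f → r f e)
    (htrans : ∀ e f g, wall e = wall f → r e f → r f g → r e g)
    (hinv : ∀ e, r e (X.inv e)) (hsq : ∀ e e' g g', X.IsSquare e e' g g' → r e g')
    {e f : X.Cell 1} (h : wall e = wall f) : r e f := by
  replace h := Quot.eqvGen_exact h
  induction h with
  | rel e f h =>
    rcases h with rfl | ⟨e', g, h⟩
    · exact hinv e
    · exact hsq _ _ _ _ h
  | refl e => exact hrefl e
  | symm e f _ ih => exact hsymm _ _ ih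
  | trans e f g h h' ih ih' =>
    exact htrans _ _ _ (Quot.eqvGen_sound h) ih ih'

open Classical in
/-- The number of times that a path crosses a wall. -/
noncomputable def wallCount (H : X.Wall) (l : List (X.Cell 1)) : ℕ := (l.map wall).count H

@[simp] theorem wallCount_nil (H : X.Wall) : wallCount H [] = 0 := rfl

open Classical in
theorem wallCount_cons (H : X.Wall) (e : X.Cell 1) (l : List (X.Cell 1)) :
    wallCount H (e :: l) = wallCount H l + if wall e = H then 1 else 0 := by
  simp [wallCount, List.count_cons]

theorem wallCount_append (H : X.Wall) (l l' : List (X.Cell 1)) :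
    wallCount H (l ++ l') = wallCount H l + wallCount H l' := by
  simp [wallCount]

theorem wallCount_of_step {hX : X.IsNonpositivelyCurved} {l l' : List (X.Cell 1)}
    (h : hX.squares.Step l l') (H : X.Wall) : wallCount H l = wallCount H l' := by
  induction h with
  | cons e _ ih => rw [wallCount_cons, wallCount_cons, ih]
  | @flip e e' g g' l h =>
    have h1 : wall e = wall g' := IsSquare.wall_eq h
    have h2 : wall e' = wall g := IsSquare.wall_eq' h
    rw [wallCount_cons, wallCount_cons, wallCount_cons, wallCount_cons, h1, h2]
    omega

theorem wallCount_of_eqv {hX : X.IsNonpositivelyCurved} {l l' : List (X.Cell 1)}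
    (h : hX.squares.Eqv l l') (H : X.Wall) : wallCount H l = wallCount H l' := by
  induction h with
  | refl => rfl
  | tail _ h ih => exact ih.trans (wallCount_of_step h H)

/-- A cancelled backtrack crosses one wall twice. -/
theorem wallCount_act_mod_two (hX : X.IsNonpositivelyCurved) (H : X.Wall) (e : X.Cell 1)
    (l : List (X.Cell 1)) :
    wallCount H (hX.squares.act e l) % 2 = wallCount H (e :: l) % 2 := by
  by_cases hex : ∃ q, hX.squares.Eqv l (X.inv e :: q)
  · obtain ⟨q, hq⟩ := hex
    rw [wallCount_of_eqv (SquareSystem.act_of_eqv hq), wallCount_cons, wallCount_of_eqv hq,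
      wallCount_cons, wall_inv]
    omega
  · push Not at hex
    rw [SquareSystem.act_of_not hex]

theorem wallCount_reduce_mod_two (hX : X.IsNonpositivelyCurved) (H : X.Wall)
    (l : List (X.Cell 1)) :
    wallCount H (hX.squares.reduce l []) % 2 = wallCount H l % 2 := by
  induction l with
  | nil => rfl
  | cons e l ih =>
    rw [SquareSystem.reduce_cons, wallCount_act_mod_two, wallCount_cons, wallCount_cons]
    omega

namespace IsCAT0

variable (hX : X.IsCAT0)

/-- The wall `H` separates two vertices. -/
def Sep (H : X.Wall) (a b : X.Cell 0) : Prop := Odd (wallCount H (hX.geod a b))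

theorem odd_wallCount_iff {a b : X.Cell 0} {p : List (X.Cell 1)} (hp : X.IsEdgePath a b p)
    (H : X.Wall) : Odd (wallCount H p) ↔ hX.Sep H a b := by
  have h := wallCount_reduce_mod_two hX.nonpositivelyCurved H p
  rw [wallCount_of_eqv (hX.reduce_eqv_geod hp)] at h
  rw [Sep, Nat.odd_iff, Nat.odd_iff, h]

theorem sep_self (H : X.Wall) (a : X.Cell 0) : ¬ hX.Sep H a a := by
  rw [← hX.odd_wallCount_iff (p := []) rfl]
  simp

theorem sep_iff (H : X.Wall) (a b c : X.Cell 0) :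
    hX.Sep H a c ↔ ¬ (hX.Sep H a b ↔ hX.Sep H b c) := by
  rw [← hX.odd_wallCount_iff (isEdgePath_append (hX.geod_path a b) (hX.geod_path b c)),
    wallCount_append, Nat.odd_add, Sep, Sep, ← Nat.not_odd_iff_even]
  tauto

theorem sep_comm (H : X.Wall) (a b : X.Cell 0) : hX.Sep H a b ↔ hX.Sep H b a := by
  have h1 := hX.sep_iff H a b a
  have h2 := hX.sep_self H a
  tauto

theorem sep_edge (H : X.Wall) (e : X.Cell 1) :
    hX.Sep H (X.src e) (X.tgt e) ↔ wall e = H := by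
  rw [← hX.odd_wallCount_iff (p := [e]) ⟨rfl, rfl⟩, wallCount_cons, wallCount_nil]
  split_ifs with h <;> simp [h]

/-- The sides of an edge depend only on its wall. -/
theorem desc_iff_of_wall_eq {e f : X.Cell 1} (h : wall e = wall f) (x y : X.Cell 0) :
    (hX.Desc e x ↔ hX.Desc e y) ↔ (hX.Desc f x ↔ hX.Desc f y) := by
  refine wall_induction (r := fun e f => (hX.Desc e x ↔ hX.Desc e y) ↔ (hX.Desc f x ↔ hX.Desc f y))
    (fun _ => Iff.rfl) (fun _ _ h => h.symm) (fun _ _ _ _ h h' => h.trans h') ?_ ?_ h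
  · intro e
    simp only [hX.desc_inv]
    tauto
  · intro e e' g g' hs
    rw [hX.desc_opposite_iff hs, hX.desc_opposite_iff hs]

/-- A geodesic crosses each wall at most once. -/
theorem nodup_of_red {p : List (X.Cell 1)} : ∀ {a b : X.Cell 0}, X.IsEdgePath a b p →
    hX.squares.Red p → (p.map wall).Nodup := by
  induction p with
  | nil => simp
  | cons e p ih =>
    intro a b hp hr
    rw [List.map_cons, List.nodup_cons]
    refine ⟨fun hmem => ?_, ih hp.2 hr.1⟩
    obtain ⟨f, hf, hfe⟩ := List.mem_map.1 hmem
    obtain ⟨p₁, p₂, rfl⟩ := List.append_of_mem hf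
    obtain ⟨c, h1, h2⟩ := exists_of_isEdgePath_append hp.2
    obtain rfl := h2.1
    have hr2 : hX.squares.Red ((e :: p₁) ++ (f :: p₂)) := hr
    have hr3 : hX.squares.Red ((e :: (p₁ ++ [f])) ++ p₂) := by
      simpa [List.append_assoc] using hr
    -- Prefixes of the geodesic show that `e` points towards both ends of `f`. Since `f` has the
    -- same wall, its ends would be on one side of that wall.
    have d1 : hX.Desc e (X.src f) := hX.desc_of_red h1 hr2.of_append
    have d2 : hX.Desc e (X.tgt f) :=
      
      hX.desc_of_red (isEdgePath_append h1 (l' := [f]) ⟨rfl, rfl⟩) hr3.of_append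
    have h3 := (hX.desc_iff_of_wall_eq hfe (X.src f) (X.tgt f)).2 (iff_of_true d1 d2)
    exact hX.not_desc_src f (h3.2 (hX.desc_tgt f))

theorem sep_iff_mem {H : X.Wall} {a b : X.Cell 0} {p : List (X.Cell 1)} (hp : X.IsEdgePath a b p)
    (hr : hX.squares.Red p) : hX.Sep H a b ↔ H ∈ p.map wall := by
  classical
  have h1 := List.nodup_iff_count_le_one.1 (hX.nodup_of_red hp hr) H
  rw [← hX.odd_wallCount_iff hp, ← List.count_pos_iff]
  have h2 : wallCount H p = List.count H (p.map wall) := by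
    unfold wallCount
    congr
  rw [h2, Nat.odd_iff]
  omega

theorem edist_eq_ncard (a b : X.Cell 0) : hX.edist a b = {H | hX.Sep H a b}.ncard := by
  classical
  have h1 : {H | hX.Sep H a b} = (((hX.geod a b).map wall).toFinset : Set X.Wall) := by
    ext H
    simp only [Set.mem_ofPred_eq, List.coe_toFinset]
    exact hX.sep_iff_mem (hX.geod_path a b) (hX.geod_red a b)
  rw [h1, Set.ncard_coe_finset,
    List.toFinset_card_of_nodup (hX.nodup_of_red (hX.geod_path a b) (hX.geod_red a b)),
    List.length_map, edist]

theorem desc_iff_sep (e : X.Cell 1) (x : X.Cell 0) :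
    hX.Desc e x ↔ hX.Sep (wall e) (X.src e) x := by
  constructor
  · intro h
    rw [hX.sep_iff_mem (p := e :: hX.geod (X.tgt e) x) ⟨rfl, hX.geod_path _ _⟩ h.red]
    simp
  · intro hs
    by_contra hd
    rw [← hX.desc_inv] at hd
    have h1 := hX.sep_iff_mem (H := wall e) (a := X.tgt e) (b := x)
      (p := X.inv e :: hX.geod (X.tgt (X.inv e)) x) ⟨X.src_inv e, hX.geod_path _ _⟩ hd.red
    have h2 : hX.Sep (wall e) (X.tgt e) x := h1.2 (by simp [wall_inv])
    have h3 := (hX.sep_edge (wall e) e).2 rfl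
    have h4 := hX.sep_iff (wall e) (X.src e) (X.tgt e) x
    tauto

/-! ### Crossing walls -/

end IsCAT0

/-- Two distinct walls cross if some square is dual to both. -/
def Cross (H K : X.Wall) : Prop :=
  H ≠ K ∧ ∃ e e' g g', X.IsSquare e e' g g' ∧ wall e = H ∧ wall e' = K

theorem Cross.symm {H K : X.Wall} (h : Cross H K) : Cross K H := by
  obtain ⟨hne, e, e', g, g', hs, he, he'⟩ := h
  exact ⟨hne.symm, e', e, g', g, hs.symm, he', he⟩

namespace IsCAT0

variable (hX : X.IsCAT0)

/-- If two edges of a wall are separated by another wall, then the walls cross. -/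
theorem cross_of_sep {e f : X.Cell 1} {K : X.Wall} (h : wall e = wall f) (hne : wall e ≠ K)
    (hs : hX.Sep K (X.src e) (X.src f)) : Cross (wall e) K := by
  by_contra hc
  refine wall_induction (r := fun e f => wall e ≠ K → ¬ Cross (wall e) K → wall e = wall f →
    ¬ hX.Sep K (X.src e) (X.src f)) ?_ ?_ ?_ ?_ ?_ h hne hc h hs
  · intro e _ _ _
    exact hX.sep_self K _
  · intro e f hr h1 h2 h3
    rw [hX.sep_comm]
    exact hr (h3 ▸ h1) (h3 ▸ h2) h3.symm
  · intro e f g hef hr hr' h1 h2 h3 hs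
    have h4 := hr h1 h2 hef
    have h5 := hr' (hef ▸ h1) (hef ▸ h2) (hef.symm.trans h3)
    rw [hX.sep_iff K _ (X.src f)] at hs
    exact hs (iff_of_false h4 h5)
  · intro e h1 _ _
    rwa [X.src_inv, hX.sep_edge]
  · intro e e' g g' hsq h1 h2 _
    -- The sources of opposite edges are joined by `e'`, which is dual to `K` only if the square
    -- witnesses a crossing.
    rw [hsq.src_right, hsq.src_eq, hX.sep_edge]
    exact fun h3 => h2 ⟨h1, e, e', g, g', hsq, rfl, h3⟩

/-- The corners of a square dual to both walls realize all four combinations of sides. -/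
theorem exists_sep_sep {H K : X.Wall} (h : Cross H K) (v : X.Cell 0) :
    ∃ x, hX.Sep H v x ∧ hX.Sep K v x := by
  obtain ⟨hne, e, e', g, g', hs, rfl, rfl⟩ := h
  have a1 := (hX.sep_edge (wall e) e).2 rfl
  have a2 := mt (hX.sep_edge (wall e') e).1 hne
  have b1 := (hX.sep_edge (wall e') e').2 rfl
  have b2 := mt (hX.sep_edge (wall e) e').1 hne.symm
  have c1 := (hX.sep_edge (wall e') g).2 hs.wall_eq'.symm
  have c2 := mt (hX.sep_edge (wall e) g).1 (fun h => hne (h.symm.trans hs.wall_eq'.symm))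
  rw [hs.src_left] at c1 c2
  rw [← hs.src_eq] at b1 b2
  have d1 := hX.sep_iff (wall e) v (X.src e) (X.tgt e)
  have d2 := hX.sep_iff (wall e') v (X.src e) (X.tgt e)
  have d3 := hX.sep_iff (wall e) v (X.src e) (X.tgt e')
  have d4 := hX.sep_iff (wall e') v (X.src e) (X.tgt e')
  have d5 := hX.sep_iff (wall e) v (X.tgt e) (X.tgt g)
  have d6 := hX.sep_iff (wall e') v (X.tgt e) (X.tgt g)
  by_cases h1 : hX.Sep (wall e) v (X.src e) <;> by_cases h2 : hX.Sep (wall e') v (X.src e)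
  · exact ⟨_, h1, h2⟩
  · exact ⟨X.tgt e', by simp [d3, h1, b2], by simp [d4, h2, b1]⟩
  · exact ⟨X.tgt e, by simp [d1, h1, a1], by simp [d2, h2, a2]⟩
  · exact ⟨X.tgt g, by simp [d5, d1, h1, a1, c2], by simp [d6, d2, h2, a2, c1]⟩

end IsCAT0

end CubeComplex

/-! ### Pairwise crossing walls and cubes -/

namespace CubeComplex

variable {X : CubeComplex.{u}}

namespace IsCAT0

variable (hX : X.IsCAT0)

theorem isSquare_of_cross (hX : X.IsCAT0) {e f : X.Cell 1} (hsrc : X.src e = X.src f)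
    (hc : Cross (wall e) (wall f)) : ∃ g g', X.IsSquare e f g g' := by
  obtain ⟨x, h1, h2⟩ := hX.exists_sep_sep hc (X.src e)
  have he := (hX.desc_iff_sep e x).2 h1
  have hf := (hX.desc_iff_sep f x).2 (hsrc ▸ h2)
  obtain ⟨g, g', -, h, -⟩ := hX.isSquare_of_desc hsrc (fun h => hc.1 (h ▸ rfl)) he hf
  exact ⟨g, g', h⟩

/-- A vertex of the halfspace bounded by `K` that is nearest to `v` lies on a geodesic from `v` to
every vertex of the halfspace. -/
theorem edist_add_edist_of_nearest {K : X.Wall} {v w x : X.Cell 0} (hw : hX.Sep K v w)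
    (hx : hX.Sep K v x) (hmin : ∀ u, hX.Sep K v u → hX.edist v w ≤ hX.edist v u) :
    hX.edist v w + hX.edist w x ≤ hX.edist v x := by
  by_contra! hlt
  have hpath := isEdgePath_append ((hX.geod_path w v).rev hX.nonpositivelyCurved) (hX.geod_path w x)
  have hlen := (hX.reduce_eqv_geod hpath).length_eq
  rw [SquareSystem.reduce_append] at hlen
  have hlen2 := ((SquareSystem.reduce_congr (hX.squares.rev (hX.geod w v))
    (SquareSystem.reduce_eqv_of_red (hX.geod_red w x))).length_eq).symm.trans hlen
  rw [hX.edist_comm v w] at hlt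
  -- If the detour through `w` is not geodesic, geodesics from `w` to `v` and to `x` may be taken to
  -- share their first edge `e`. By minimality `e` leaves the halfspace, so it is dual to `K`;
  -- pointing towards `x`, it puts `x` outside as well.
  obtain ⟨e, r, t, h1, h2⟩ := SquareSystem.exists_common_edge (hX.geod_red w v) (hX.geod_red w x)
    (hlen2.trans_lt hlt)
  obtain ⟨rfl, hd1⟩ := hX.desc_of_eqv h1
  obtain ⟨-, hd2⟩ := hX.desc_of_eqv h2
  have hu : ¬ hX.Sep K v (X.tgt e) := fun hu => by
    have := hmin _ hu
    rw [hX.edist_comm v, hX.edist_comm v] at this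
    exact absurd hd1 (not_lt.2 this)
  have h3 := hX.sep_iff K v (X.src e) (X.tgt e)
  have h4 : hX.Sep K (X.src e) (X.tgt e) := by tauto
  have h5 := (hX.sep_edge K e).1 h4
  rw [hX.desc_iff_sep, h5] at hd2
  have h6 := hX.sep_iff K v (X.src e) x
  tauto

/-- Finitely many pairwise crossing walls have dual edges at a common vertex. -/
theorem exists_vertex_of_pairwise_cross (hX : X.IsCAT0) (S : Finset X.Wall)
    (hS : ∀ H ∈ S, ∀ K ∈ S, H ≠ K → Cross H K) :
    ∃ v, ∀ H ∈ S, ∃ e : X.Cell 1, X.src e = v ∧ wall e = H := by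
  classical
  induction S using Finset.induction_on with
  | empty => exact ⟨hX.simplyConnected.nonempty.some, by simp⟩
  | insert K S hK ih =>
    obtain ⟨v₀, hv₀⟩ := ih fun H hH K hK =>
      hS H (Finset.mem_insert_of_mem hH) K (Finset.mem_insert_of_mem hK)
    obtain ⟨w₀, hw₀⟩ : ∃ w, hX.Sep K v₀ w := by
      obtain ⟨e, rfl⟩ := Quot.exists_rep K
      have h1 := (hX.sep_edge _ e).2 rfl
      have h2 := hX.sep_iff (wall e) v₀ (X.src e) (X.tgt e)
      by_cases h3 : hX.Sep (wall e) v₀ (X.src e)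
      · exact ⟨_, h3⟩
      · exact ⟨X.tgt e, h2.2 fun h => h3 (h.2 h1)⟩
    -- Choose `v` carrying edges dual to all of `S`, and `w` beyond `K`, at minimal distance. The
    -- first edge `f` of a geodesic from `v` to `w` turns out to be dual to `K`.
    have hex : ∃ m v w, (∀ H ∈ S, ∃ e : X.Cell 1, X.src e = v ∧ wall e = H) ∧ hX.Sep K v w ∧
        hX.edist v w = m := ⟨_, v₀, w₀, hv₀, hw₀, rfl⟩
    obtain ⟨v, w, hv, hw, hm⟩ := Nat.find_spec hex
    have hmin : ∀ v' w', (∀ H ∈ S, ∃ e : X.Cell 1, X.src e = v' ∧ wall e = H) → hX.Sep K v' w' →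
        hX.edist v w ≤ hX.edist v' w' := fun v' w' h1 h2 =>
      hm.le.trans (Nat.find_min' hex ⟨v', w', h1, h2, rfl⟩)
    obtain ⟨f, hf, hfw⟩ : ∃ f : X.Cell 1, X.src f = v ∧ hX.Desc f w := by
      rcases hg : hX.geod v w with _ | ⟨f, q⟩
      · have h1 := hX.geod_path v w
        rw [hg] at h1
        obtain rfl : v = w := h1
        exact absurd hw (hX.sep_self K v)
      · exact ⟨f, hX.desc_of_eqv (p := q) (by rw [hg])⟩
    subst hf
    by_cases hfK : wall f = K
    · exact ⟨X.src f, fun H hH => (Finset.mem_insert.1 hH).elim (fun h => ⟨f, rfl, hfK.trans h.symm⟩)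
        (hv H)⟩
    exfalso
    have hsep : hX.Sep K (X.tgt f) w := by
      have h1 := hX.sep_iff K (X.src f) (X.tgt f) w
      have h2 := mt (hX.sep_edge K f).1 hfK
      tauto
    -- Otherwise `X.tgt f`, which is nearer to `w`, would still carry edges dual to all of `S`,
    -- against minimality.
    refine absurd hfw (not_lt.2 (hmin _ _ (fun H hH => ?_) hsep))
    obtain ⟨e, he, heH⟩ := hv H hH
    by_cases hef : wall f = H
    · exact ⟨X.inv f, X.src_inv f, (wall_inv f).trans hef⟩
    have hHK : H ≠ K := fun h => hK (h ▸ hH)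
    obtain ⟨x, hx1, hx2⟩ := hX.exists_sep_sep
      (hS H (Finset.mem_insert_of_mem hH) K (Finset.mem_insert_self _ _) hHK) (X.src f)
    -- A geodesic from `v` to `x` may pass through `w`, so `f` points towards `x`, as does `e`. They
    -- span a square, whose edge opposite to `e` starts at `X.tgt f`.
    have hgate := hX.edist_add_edist_of_nearest hw hx2 fun u hu => hmin _ _ hv hu
    have hfx : hX.Desc f x := by
      have h1 := hX.edist_triangle (X.tgt f) w x
      unfold Desc at hfw ⊢
      omega
    have hex : hX.Desc e x := by
      rw [hX.desc_iff_sep, heH, he]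
      exact hx1
    obtain ⟨g, g', -, hsq, -⟩ := hX.isSquare_of_desc he (fun h => hef (h ▸ heH)) hex hfx
    exact ⟨g', hsq.src_right, hsq.wall_eq.symm.trans heH⟩

/-- A set of pairwise crossing walls is dual to a cube. -/
theorem exists_cell_of_pairwise_cross (hX : X.IsCAT0) (S : Finset X.Wall)
    (hS : ∀ H ∈ S, ∀ K ∈ S, H ≠ K → Cross H K) : Nonempty (X.Cell S.card) := by
  obtain ⟨v, hv⟩ := hX.exists_vertex_of_pairwise_cross S hS
  choose e he heH using hv
  have hmem : ∀ i, ((S.equivFin.symm i : S) : X.Wall) ∈ S := fun i => Subtype.coe_prop _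
  obtain ⟨c, -, -⟩ := hX.nonpositivelyCurved.flag v
    (fun i : Fin S.card => e (S.equivFin.symm i : S) (hmem i)) (fun i => he _ (hmem i)) (by
      intro i j hij
      have hne : ((S.equivFin.symm i : S) : X.Wall) ≠ (S.equivFin.symm j : S) := fun h =>
        hij (S.equivFin.symm.injective (Subtype.ext h))
      obtain ⟨g, g', s, h1, h2, -⟩ := hX.isSquare_of_cross
        ((he _ (hmem i)).trans (he _ (hmem j)).symm)
        (by rw [heH _ (hmem i), heH _ (hmem j)]; exact hS _ (hmem i) _ (hmem j) hne)
      exact ⟨s, h1, h2⟩)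
  exact ⟨c⟩

/-! ### The one-skeleton -/

theorem adj_edge (hX : X.IsCAT0) (e : X.Cell 1) : X.oneSkeleton.Adj (X.src e) (X.tgt e) :=
  ⟨hX.hasSimplicialSkeleton.no_loop e, e, rfl, rfl⟩

theorem exists_walk (hX : X.IsCAT0) {a b : X.Cell 0} {p : List (X.Cell 1)}
    (hp : X.IsEdgePath a b p) : ∃ q : X.oneSkeleton.Walk a b, q.length = p.length := by
  induction p generalizing a with
  | nil => obtain rfl : a = b := hp; exact ⟨.nil, rfl⟩
  | cons e p ih =>
    obtain ⟨rfl, hp⟩ := hp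
    obtain ⟨q, hq⟩ := ih hp
    exact ⟨.cons (hX.adj_edge e) q, by simp [hq]⟩

theorem dist_le_edist (a b : X.Cell 0) : X.oneSkeleton.dist a b ≤ hX.edist a b := by
  obtain ⟨q, hq⟩ := hX.exists_walk (hX.geod_path a b)
  exact (SimpleGraph.dist_le q).trans hq.le

theorem connected_oneSkeleton (hX : X.IsCAT0) : X.oneSkeleton.Connected := by
  have := hX.simplyConnected.nonempty
  exact ⟨fun a b => ⟨(hX.exists_walk (hX.geod_path a b)).choose⟩⟩

end IsCAT0

/-! ### Cycles in the one-skeleton -/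

section Cycle

variable {n : ℕ} (c : GraphCycle X.oneSkeleton n)

/-- The oriented edges of a cycle in the one-skeleton. -/
noncomputable def cycleEdge (i : ZMod n) : X.Cell 1 := (c.adj i).2.choose

theorem src_cycleEdge (i : ZMod n) : X.src (cycleEdge c i) = c.vert i :=
  (c.adj i).2.choose_spec.1

theorem tgt_cycleEdge (i : ZMod n) : X.tgt (cycleEdge c i) = c.vert (i + 1) :=
  (c.adj i).2.choose_spec.2

/-- The edge path along a segment of a cycle. -/
noncomputable def cyclePath (i : ZMod n) : ℕ → List (X.Cell 1)
  | 0 => []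
  | k + 1 => cyclePath i k ++ [cycleEdge c (i + (k : ZMod n))]

theorem isEdgePath_cyclePath (i : ZMod n) (k : ℕ) :
    X.IsEdgePath (c.vert i) (c.vert (i + (k : ZMod n))) (cyclePath c i k) := by
  induction k with
  | zero => simp [cyclePath, IsEdgePath]
  | succ k ih =>
    refine isEdgePath_append ih ⟨src_cycleEdge c _, (tgt_cycleEdge c _).trans ?_⟩
    rw [Nat.cast_succ, add_assoc]

/-- The coloring of the edges of a cycle by the walls that they cross. -/
noncomputable def cycleColor (i : ZMod n) : Set.range fun i => wall (cycleEdge c i) :=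
  ⟨wall (cycleEdge c i), i, rfl⟩

theorem wallCount_cyclePath (i : ZMod n) (k : ℕ) (x : Set.range fun i => wall (cycleEdge c i)) :
    wallCount x.1 (cyclePath c i k) =
      {j : ℕ | j < k ∧ cycleColor c (i + (j : ZMod n)) = x}.ncard := by
  classical
  rw [ncard_segment]
  induction k with
  | zero => simp [cyclePath]
  | succ k ih =>
    rw [cyclePath, wallCount_append, ih, Finset.range_add_one, Finset.filter_insert,
      wallCount_cons, wallCount_nil]
    have : cycleColor c (i + (k : ZMod n)) = x ↔ wall (cycleEdge c (i + (k : ZMod n))) = x.1 :=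
      Subtype.ext_iff
    by_cases h : cycleColor c (i + (k : ZMod n)) = x
    · rw [if_pos h, if_pos (this.1 h), Finset.card_insert_of_notMem (by simp)]
    · rw [if_neg h, if_neg (mt this.2 h), Nat.zero_add, Nat.add_zero]

variable (hX : X.IsCAT0)

theorem segmentCrosses_cycleColor (i : ZMod n) (k : ℕ)
    (x : Set.range fun i => wall (cycleEdge c i)) :
    SegmentCrosses (cycleColor c) i k x ↔
      hX.Sep x.1 (c.vert i) (c.vert (i + (k : ZMod n))) := by
  rw [SegmentCrosses, ← wallCount_cyclePath, hX.odd_wallCount_iff (isEdgePath_cyclePath c i k)]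

theorem isWallCycle_cycleColor (hX : X.IsCAT0) (hn : 0 < n) : IsWallCycle (cycleColor c) := by
  classical
  refine ⟨?_, fun x => ?_⟩
  · rintro ⟨_, i, rfl⟩
    exact ⟨i, rfl⟩
  -- Going once around the cycle returns to the same vertex, which no wall separates from itself.
  · have h := segmentCrosses_cycleColor c hX 0 n x
    rw [SegmentCrosses, ncard_segment] at h
    simp only [zero_add, CharP.cast_eq_zero] at h
    rw [ncard_fiber hn, ← Nat.not_odd_iff_even]
    exact fun h' => hX.sep_self _ _ (h.1 (by convert h'))

theorem wallDist_cycleColor (hn : 0 < n) (a b : ZMod n) :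
    wallDist (cycleColor c) a b = hX.edist (c.vert a) (c.vert b) := by
  have : NeZero n := ⟨hn.ne'⟩
  have hval : a + (((b - a).val : ℕ) : ZMod n) = b := by
    rw [ZMod.natCast_zmod_val, add_sub_cancel]
  rw [wallDist, hX.edist_eq_ncard, ← Set.ncard_image_of_injective _ Subtype.val_injective]
  congr 1
  ext H
  simp only [Set.mem_image, Set.mem_ofPred_eq, segmentCrosses_cycleColor c hX, hval]
  constructor
  · rintro ⟨x, hx, rfl⟩
    exact hx
  · intro hH
    refine ⟨⟨H, ?_⟩, hH, rfl⟩
    -- A wall dual to no edge of the cycle separates no two of its vertices.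
    by_contra hr
    have hp := isEdgePath_cyclePath c a (b - a).val
    rw [hval] at hp
    have h0 : ∀ k, wallCount H (cyclePath c a k) = 0 := fun k => by
      induction k with
      | zero => rfl
      | succ k ih =>
        rw [cyclePath, wallCount_append, ih, wallCount_cons, wallCount_nil,
          if_neg fun h => hr ⟨_, h⟩]
    rw [← hX.odd_wallCount_iff hp, h0] at hH
    exact absurd hH (by decide)

theorem cross_of_wallsCross (hX : X.IsCAT0) {x y : Set.range fun i => wall (cycleEdge c i)}
    (h : WallsCross (cycleColor c) x y) : Cross x.1 y.1 := by
  have key : ∀ {x y : Set.range fun i => wall (cycleEdge c i)} {i : ZMod n} {k : ℕ}, x ≠ y →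
      SegmentBeginsEnds (cycleColor c) i k x → SegmentCrosses (cycleColor c) i k y →
      Cross x.1 y.1 := by
    rintro x y i k hne ⟨hk, h1, h2⟩ h3
    obtain ⟨k, rfl⟩ : ∃ l, k = l + 1 := ⟨k - 1, by omega⟩
    rw [Nat.add_sub_cancel] at h2
    have h1' : wall (cycleEdge c i) = x.1 := congrArg Subtype.val h1
    have h2' : wall (cycleEdge c (i + (k : ZMod n))) = x.1 := congrArg Subtype.val h2
    have hne' : x.1 ≠ y.1 := fun h => hne (Subtype.ext h)
    rw [segmentCrosses_cycleColor c hX, hX.sep_iff _ _ (c.vert (i + (k : ZMod n)))] at h3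
    -- The last edge of the segment is dual to `x`, so dropping it does not affect separation by
    -- `y`: the wall `y` separates the sources of two edges dual to `x`.
    have h4 : ¬ hX.Sep y.1 (c.vert (i + (k : ZMod n))) (c.vert (i + ((k + 1 : ℕ) : ZMod n))) := by
      rw [Nat.cast_succ, ← add_assoc, ← tgt_cycleEdge, ← src_cycleEdge, hX.sep_edge, h2']
      exact hne'
    rw [← h1']
    refine hX.cross_of_sep (h1'.trans h2'.symm) (h1' ▸ hne') ?_
    rw [src_cycleEdge, src_cycleEdge]
    tauto
  obtain ⟨hne, i, k, -, ⟨h1, h2⟩ | ⟨h1, h2⟩⟩ := h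
  · exact key hne h1 h2
  · exact (key hne.symm h1 h2).symm

theorem wallDim_cycleColor_le (hX : X.IsCAT0) {d : ℕ} (hd : ∀ n, d < n → IsEmpty (X.Cell n)) :
    wallDim (cycleColor c) ≤ max 1 d := by
  refine max_le_max le_rfl (csSup_le' ?_)
  rintro k ⟨S, hS, rfl⟩
  by_contra! hlt
  have hcard : (S.map (Function.Embedding.subtype _)).card = S.card := Finset.card_map _
  obtain ⟨q⟩ := hX.exists_cell_of_pairwise_cross (S.map (Function.Embedding.subtype _)) (by
    intro H hH K hK hne
    obtain ⟨x, hx, rfl⟩ := Finset.mem_map.1 hH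
    obtain ⟨y, hy, rfl⟩ := Finset.mem_map.1 hK
    exact cross_of_wallsCross c hX (hS x hx y hy fun h => hne (h ▸ rfl)))
  rw [hcard] at q
  exact (hd _ hlt).false q

end Cycle

end CubeComplex

/-! ### Almost isometric cycles and the strong shortcut property -/

theorem EdgePoint.dist_le_of_pos_eq_zero {V : Type u} {G : SimpleGraph V} (p q : EdgePoint G)
    (hp : p.pos = 0) (hq : q.pos = 0) : p.dist q ≤ G.dist p.dart.fst q.dart.fst := by
  unfold EdgePoint.dist
  split_ifs with h1 h2
  · rw [hp, hq]
    simp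
  · have hadj : G.Adj p.dart.fst q.dart.fst := by
      rw [h2]
      exact q.dart.adj.symm
    rw [hp, hq, SimpleGraph.dist_eq_one_iff_adj.2 hadj]
    simp
  · refine (min_le_left _ _).trans ((min_le_left _ _).trans ?_)
    rw [hp, hq]
    simp

theorem GraphCycle.IsAlmostIsometric.le_dist {V : Type u} {G : SimpleGraph V} {n : ℕ}
    {c : GraphCycle G n} {ξ : ℝ} (h : c.IsAlmostIsometric ξ) (hn : 0 < n) {a b : ZMod n}
    (hab : 2 * (b - a).val = n) : ξ * ((n : ℝ) / 2) ≤ G.dist (c.vert a) (c.vert b) := by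
  have : NeZero n := ⟨hn.ne'⟩
  have ht : ((a.val : ℤ) : ℝ) + (n : ℝ) / 2 = ((a.val + (b - a).val : ℤ) : ℝ) := by
    have h0 : (n : ℝ) = 2 * (b - a).val := by exact_mod_cast hab.symm
    push_cast
    linarith
  have h1 := h ((a.val : ℤ) : ℝ)
  rw [ht] at h1
  refine h1.trans ((EdgePoint.dist_le_of_pos_eq_zero _ _ (Int.fract_intCast _)
    (Int.fract_intCast _)).trans (le_of_eq ?_))
  have e1 : (c.point ((a.val : ℤ) : ℝ)).dart.fst = c.vert a := by
    change c.vert _ = _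
    rw [Int.floor_intCast]
    simp
  have e2 : (c.point ((a.val + (b - a).val : ℤ) : ℝ)).dart.fst = c.vert b := by
    change c.vert _ = _
    rw [Int.floor_intCast]
    simp
  rw [e1, e2]

theorem CubeComplex.IsCAT0.isStronglyShortcut {X : CubeComplex.{u}} (hX : X.IsCAT0)
    (hd : X.IsFiniteDimensional) : IsStronglyShortcut X.oneSkeleton := by
  obtain ⟨d, hd⟩ := hd
  set D := max 1 d with hD
  have hD1 : (1 : ℝ) ≤ D := by exact_mod_cast le_max_left 1 d
  -- The ratio `(5 * k - 1) / (5 * k)` increases with `k`, so its value at the upper bound `D`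
  -- serves for cycles of every dimension `k ≤ D`; likewise `50 * k ^ 2 / (5 * k - 1) ≤ 50 * D ^ 2`.
  refine ⟨hX.connected_oneSkeleton, 50 * D ^ 2, (5 * (D : ℝ) - 1) / (5 * D), ?_, ?_, ?_⟩
  · apply div_pos <;> linarith
  · rw [div_lt_one (by linarith)]
    linarith
  · intro n hn c hc
    have hk1 : 1 ≤ wallDim (cycleColor c) := le_max_left _ _
    have hkD : wallDim (cycleColor c) ≤ D := wallDim_cycleColor_le c hX hd
    set k := wallDim (cycleColor c) with hk
    have hk1' : (1 : ℝ) ≤ k := by exact_mod_cast hk1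
    have hkD' : (k : ℝ) ≤ D := by exact_mod_cast hkD
    have h1 := length_le_of_wallDist_ge hn (cycleColor c) k (isWallCycle_cycleColor c hX hn) hk (by
      intro a b hab
      rw [wallDist_cycleColor c hX hn]
      have h2 := hc.le_dist hn hab
      have h3 : (X.oneSkeleton.dist (c.vert a) (c.vert b) : ℝ) ≤ hX.edist (c.vert a) (c.vert b) := by
        exact_mod_cast hX.dist_le_edist _ _
      refine le_trans (mul_le_mul_of_nonneg_right ?_ (by positivity)) (h2.trans h3)
      rw [div_le_div_iff₀ (by linarith) (by linarith)]
      nlinarith)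
    have h2 : (n : ℝ) ≤ 50 * (D : ℝ) ^ 2 := by
      refine h1.trans ((div_le_self (by positivity) (by linarith)).trans ?_)
      gcongr
    exact_mod_cast h2

theorem IsCocompactlyCubulated.isStronglyShortcutGroup {Γ : Type v} [Group Γ]
    (h : IsCocompactlyCubulated Γ) : IsStronglyShortcutGroup Γ := by
  obtain ⟨X, act, hX, hequiv, hstab, S, hS, hcov⟩ := h
  -- Finitely many orbits of cubes realize only finitely many dimensions.
  have hfd : X.IsFiniteDimensional := by
    obtain ⟨d, hd⟩ := (hS.image Sigma.fst).bddAbove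
    refine ⟨d, fun n hn => ⟨fun c => ?_⟩⟩
    obtain ⟨g, hg⟩ := hcov n c
    exact absurd (hd ⟨_, hg, rfl⟩) (not_le.2 hn)
  have hsrc : ∀ (g : Γ) (e : X.Cell 1), X.src (g • e) = g • X.src e := fun g e => hequiv g _ e
  have htgt : ∀ (g : Γ) (e : X.Cell 1), X.tgt (g • e) = g • X.tgt e := fun g e => hequiv g _ e
  refine ⟨X.Cell 0, act 0, X.oneSkeleton, hX.isStronglyShortcut hfd, ?_, hstab, ?_, ?_⟩
  · rintro g x y ⟨hne, e, rfl, rfl⟩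
    exact ⟨fun h => hne (MulAction.injective g h), g • e, hsrc g e, htgt g e⟩
  · refine ⟨(fun c : X.Cell 0 => (⟨0, c⟩ : Σ n, X.Cell n)) ⁻¹' S,
      hS.preimage (sigma_mk_injective.injOn), fun x => ?_⟩
    exact hcov 0 x
  · refine ⟨(fun e : X.Cell 1 => (X.src e, X.tgt e)) ''
      ((fun c : X.Cell 1 => (⟨1, c⟩ : Σ n, X.Cell n)) ⁻¹' S),
      (hS.preimage (sigma_mk_injective.injOn)).image _, ?_⟩
    rintro x y ⟨-, e, rfl, rfl⟩
    obtain ⟨g, hg⟩ := hcov 1 e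
    exact ⟨g, g • e, hg, Prod.ext (hsrc g e) (htgt g e)⟩

theorem mainTheorem5 :
    (∀ X : CubeComplex.{u}, X.IsCAT0 → X.IsFiniteDimensional →
      X.HasSimplicialSkeleton ∧ IsStronglyShortcut X.oneSkeleton) ∧
    (∀ (Γ : Type v) [Group Γ], IsCocompactlyCubulated Γ → IsStronglyShortcutGroup Γ) ∧
    (∀ (n : ℕ) (W : Type w) (α : ZMod n → W) (d : ℕ), 0 < n → IsWallCycle α → d = wallDim α →
      (∀ a b : ZMod n, 2 * (b - a).val = n →
        (5 * (d : ℝ) - 1) / (5 * (d : ℝ)) * ((n : ℝ) / 2) ≤ (wallDist α a b : ℝ)) →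
      (n : ℝ) ≤ 50 * (d : ℝ) ^ 2 / (5 * (d : ℝ) - 1)) := by
  exact ⟨fun X hX hd => ⟨hX.hasSimplicialSkeleton, hX.isStronglyShortcut hd⟩,
    fun Γ _ h => h.isStronglyShortcutGroup,
    fun n W α d hn hα hd h => length_le_of_wallDist_ge hn α d hα hd h⟩
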